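/- Let $\Delta$ be a Dynkin diagram of type $A_n$ $(n\ge 1)$, $D_n$ $(n\ge 4)$, $E_6$, $E_7$ or $E_8$ with vertex set $I$, Cartan matrix $(a_{ij})$, simple roots $\alpha_i$ and simple reflections $s_i$, and let $Q$ be a quiver obtained by orienting the edges of $\Delta$. For a vertex $i$ let $s_iQ$ be the quiver obtained from $Q$ by reversing all arrows incident with $i$. Let $\tilde w=s_{i_1}s_{i_2}\cdots s_{i_t}$ be a reduced expression of a Weyl group element $w$ that is adapted to $Q$, i.e. $i_k$ is a source of $s_{i_{k-1}}\cdots s_{i_1}Q$ for all $1\le k\le t$. Let $[\tilde w]$ be its commutation class, i.e. the set of all reduced expressions obtained from $\tilde w$ by repeatedly applying relations $s_is_j=s_js_i$ with $a_{ij}=0$. For $\tilde w'=s_{j_1}\cdots s_{j_t}\in[\tilde w]$ put $\beta^{\tilde w'}_k=s_{j_1}\cdots s_{j_{k-1}}(\alpha_{j_k})$; the set $\Phi^+_w=\{\beta^{\tilde w'}_1,\dots,\beta^{\tilde w'}_t\}$ consists of positive roots and depends only on $w$. A sequence is a function $m:\Phi^+_w\to\mathbb Z_{\ge0}$; its size is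 $|m|=\sum_\beta m(\beta)$ and its weight is $\mathrm{wt}(m)=\sum_\beta m(\beta)\beta$. A pair is a sequence with values in $\{0,1\}$ and size $2$, i.e. a pair of distinct roots of $\Phi^+_w$. For sequences $m',m$ write $m'<^{\mathtt b}_{\tilde w'}m$ if there are $1\le k\le s\le t$ with $m'(\beta^{\tilde w'}_k)<m(\beta^{\tilde w'}_k)$, $m'(\beta^{\tilde w'}_s)<m(\beta^{\tilde w'}_s)$ and $m'(\beta^{\tilde w'}_r)=m(\beta^{\tilde w'}_r)$ for all $r<k$ and all $r>s$. Write $m'\prec^{\mathtt b}_{[\tilde w]}m$ if $m'<^{\mathtt b}_{\tilde w'}m$ for every $\tilde w'\in[\tilde w]$. A pair $p$ is $[\tilde w]$-simple if there is no sequence $m\prec^{\mathtt b}_{[\tilde w]}p$ with $\mathrm{wt}(m)=\mathrm{wt}(p)$. A sequence $m$ is $[\tilde w]$-simple if $|m|=1$ or every pair $\{\alpha,\beta\}$ of distinct roots with $m(\alpha),m(\beta)>0$ is a $[\tilde w]$-simple pair. Theorem. For every pair $p$ there exists a unique $[\tilde w]$-simple sequence $s$ (the $[\tilde w]$-socle of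 $p$) such that $\mathrm{wt}(s)=\mathrm{wt}(p)$ and $s\preceq^{\mathtt b}_{[\tilde w]}p$, where $\preceq^{\mathtt b}_{[\tilde w]}$ means $\prec^{\mathtt b}_{[\tilde w]}$ or equality. -/

import Mathlib

namespace AdaptedSocle

/-- `C` is the Cartan matrix of a (connected) Dynkin diagram of type `A_n` (`n ≥ 1`), `D_n` (`n ≥ 4`),
`E₆`, `E₇` or `E₈`, up to a relabelling of the vertices. -/
inductive IsADE {I : Type*} (C : Matrix I I ℤ) : Prop
  | typeA (n : ℕ) (hn : 1 ≤ n) (e : I ≃ Fin n) (h : C = (CartanMatrix.A n).submatrix e e)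
  | typeD (n : ℕ) (hn : 4 ≤ n) (e : I ≃ Fin n) (h : C = (CartanMatrix.D n).submatrix e e)
  | typeE₆ (e : I ≃ Fin 6) (h : C = CartanMatrix.E₆.submatrix e e)
  | typeE₇ (e : I ≃ Fin 7) (h : C = CartanMatrix.E₇.submatrix e e)
  | typeE₈ (e : I ≃ Fin 8) (h : C = CartanMatrix.E₈.submatrix e e)

section Quivers

variable {I : Type*}

/-- `Q` is a Dynkin quiver: an orientation of the edges of the Dynkin diagram of `C`
(`i ≠ j` are joined by an edge when `C i j ≠ 0`; in type ADE all edges are simple). -/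
structure IsDynkinQuiver (C : Matrix I I ℤ) (Q : Digraph I) : Prop where
  edge_iff : ∀ i j, (Q.Adj i j ∨ Q.Adj j i) ↔ (i ≠ j ∧ C i j ≠ 0)
  asymm : ∀ i j, Q.Adj i j → ¬ Q.Adj j i

/-- The vertex `i` is a source of `Q`: no arrow enters `i`. -/
def IsSource (Q : Digraph I) (i : I) : Prop := ∀ j, ¬ Q.Adj j i

/-- The quiver `s_i Q`: all arrows incident with `i` are reversed. -/
def reflect (i : I) (Q : Digraph I) : Digraph I where
  Adj a b := ((a = i ∨ b = i) ∧ Q.Adj b a) ∨ ((a ≠ i ∧ b ≠ i) ∧ Q.Adj a b)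

/-- The word `i₁ i₂ ⋯ i_t` is adapted to `Q`: each `i_k` is a source of `s_{i_{k-1}} ⋯ s_{i_1} Q`. -/
def IsAdapted : Digraph I → List I → Prop
  | _, [] => True
  | Q, i :: l => IsSource Q i ∧ IsAdapted (reflect i Q) l

end Quivers

section Words

variable {I : Type*}

/-- Two words differ by a single commutation relation `s_i s_j = s_j s_i` with `C i j = 0`. -/
inductive CommStep (C : Matrix I I ℤ) : List I → List I → Prop
  | swap (u v : List I) (i j : I) (h : C i j = 0) :
      CommStep C (u ++ i :: j :: v) (u ++ j :: i :: v)

/-- Commutation equivalence of words; the class of `l` is written `[l]` in the comments below. -/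
def CommEquiv (C : Matrix I I ℤ) : List I → List I → Prop := Relation.EqvGen (CommStep C)

variable [Fintype I] [DecidableEq I]

/-- The simple root `α_i` in the root lattice `I → ℤ`, the free abelian group on the simple roots. -/
def simpleRoot (i : I) : I → ℤ := Pi.single i 1

/-- The simple reflection `s_i`, that is `v ↦ v - ⟨h_i, v⟩ α_i` with `⟨h_i, α_j⟩ = C i j`. -/
def simpleReflection (C : Matrix I I ℤ) (i : I) : Module.End ℤ (I → ℤ) :=
  LinearMap.id - (LinearMap.proj i ∘ₗ C.mulVecLin).smulRight (simpleRoot i)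

/-- The Weyl group element `s_{i_1} ⋯ s_{i_t}` of a word, acting on the root lattice. -/
def wordProd (C : Matrix I I ℤ) (l : List I) : Module.End ℤ (I → ℤ) :=
  (l.map (simpleReflection C)).prod

/-- The word `l` is a reduced expression (of the Weyl group element `wordProd C l`). -/
def IsReduced (C : Matrix I I ℤ) (l : List I) : Prop :=
  ∀ l' : List I, wordProd C l' = wordProd C l → l.length ≤ l'.length

/-- The root `β_k = s_{i_1} ⋯ s_{i_{k-1}} (α_{i_k})` of a word, with positions counted from `0`. -/
def wordRoot (C : Matrix I I ℤ) (l : List I) (k : Fin l.length) : I → ℤ :=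
  wordProd C (l.take k) (simpleRoot (l.get k))

/-- The set of positive roots `Φ⁺_w = {β_1, …, β_t}` of a reduced expression of `w`. -/
def wordRoots (C : Matrix I I ℤ) (l : List I) : Set (I → ℤ) := Set.range (wordRoot C l)

end Words

section Sequences

variable {I : Type*}

/-- The order `<ᵇ` on `ℕ^N`: at the first and at the last position where the two vectors differ,
the entry of `m'` is smaller than that of `m`. -/
def BiLexLT {N : ℕ} (m' m : Fin N → ℕ) : Prop :=
  ∃ k s : Fin N, k ≤ s ∧
    (∀ t, t < k → m' t = m t) ∧ m' k < m k ∧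
    (∀ t, s < t → m' t = m t) ∧ m' s < m s

/-- The size `|m|` of a multiplicity function. -/
def size (m : (I → ℤ) →₀ ℕ) : ℕ := m.sum fun _ c => c

/-- The weight `∑ m_β β`. -/
def weight (m : (I → ℤ) →₀ ℕ) : I → ℤ := m.sum fun β c => c • β

variable [Fintype I] [DecidableEq I]

/-- A sequence on `Φ⁺_w`. It is recorded as the function that assigns to every `β ∈ Φ⁺_w` its
multiplicity, so that it does not depend on the enumeration of `Φ⁺_w`. -/
def IsRootSeq (C : Matrix I I ℤ) (l : List I) (m : (I → ℤ) →₀ ℕ) : Prop :=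
  ∀ β, m β ≠ 0 → β ∈ wordRoots C l

/-- The vector `(m_1, …, m_t)` of multiplicities of `m` in the enumeration `β_1, …, β_t` given by
the word `l`. -/
def coords (C : Matrix I I ℤ) (l : List I) (m : (I → ℤ) →₀ ℕ) : Fin l.length → ℕ :=
  fun k => m (wordRoot C l k)

/-- The order `≺ᵇ_[l]` : `m' <ᵇ m` in the enumeration of every word of the class `[l]`. -/
def ClassLT (C : Matrix I I ℤ) (l : List I) (m' m : (I → ℤ) →₀ ℕ) : Prop :=
  ∀ l', CommEquiv C l l' → BiLexLT (coords C l' m') (coords C l' m)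

/-- The reflexive closure of `ClassLT`. -/
def ClassLE (C : Matrix I I ℤ) (l : List I) (m' m : (I → ℤ) →₀ ℕ) : Prop :=
  m' = m ∨ ClassLT C l m' m

/-- A pair: a sequence with all multiplicities at most `1` and of size `2`. -/
def IsPair (C : Matrix I I ℤ) (l : List I) (p : (I → ℤ) →₀ ℕ) : Prop :=
  IsRootSeq C l p ∧ (∀ β, p β ≤ 1) ∧ size p = 2

/-- A pair is `[l]`-simple if there is no sequence of the same weight strictly below it. -/
def IsSimplePair (C : Matrix I I ℤ) (l : List I) (p : (I → ℤ) →₀ ℕ) : Prop :=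
  IsPair C l p ∧ ¬ ∃ m, IsRootSeq C l m ∧ ClassLT C l m p ∧ weight m = weight p

/-- A sequence is `[l]`-simple if it has size `1` or all pairs of distinct roots
that occur in it are `[l]`-simple pairs. -/
def IsSimpleSeq (C : Matrix I I ℤ) (l : List I) (m : (I → ℤ) →₀ ℕ) : Prop :=
  IsRootSeq C l m ∧
    (size m = 1 ∨ ∀ α β, α ≠ β → 0 < m α → 0 < m β →
      IsSimplePair C l (Finsupp.single α 1 + Finsupp.single β 1))

/-- `s` has the defining properties of the `[l]`-socle of `p`: it is an `[l]`-simple sequence of the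
same weight with `s ⪯ᵇ_[l] p`. -/
def IsSocle (C : Matrix I I ℤ) (l : List I) (p s : (I → ℤ) →₀ ℕ) : Prop :=
  IsSimpleSeq C l s ∧ weight p = weight s ∧ ClassLE C l s p

end Sequences

end AdaptedSocle

namespace AdaptedSocle

set_option linter.unusedSectionVars false

open Matrix

/-! Existence is a descent, needing neither reducedness nor adaptedness. Among the sequences of
weight `weight p` that are equal to or below `p`, take one minimal for the bilexicographic order of
`l`. If two of its roots formed a non-simple pair, replacing that pair by a smaller sequence of the
same weight would contradict minimality.

Uniqueness rests on the Euler form ⟨x, y⟩ of the quiver, numerically dim Hom − dim Ext¹. Along an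
adapted reduced word, k < m forces ⟨β_k, β_m⟩ ≤ 0 ≤ ⟨β_m, β_k⟩ (`pairwise_rootList`). The crucial
claim is that a simple pair has ⟨β_k, β_m⟩ = 0 (`not_isSimplePair`). Granting it, let two simple
sequences have equal weight and first differ at β_k, and apply ⟨β_k, ·⟩ to both weights: the later
terms vanish for each of them, the earlier ones agree, and ⟨β_k, β_k⟩ = 1, a contradiction.

For the claim, suppose ⟨α, β⟩ < 0. The vector α + β is a sum of positive roots with pairwise
nonnegative Euler form, like the dimension vector of a rigid representation. These signs and those
along the word place every summand strictly between α and β in every word of the class, so the pair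
is not simple.

Such decompositions exist for every nonnegative vector (`exists_isRigidDecomp`), by reflections at
sources in place of reflection functors. Either copies of a simple root split off and ⟨v, v⟩ drops,
or the reflected vector is again nonnegative. Vectors for which the second case always occurs form a
finite set permuted by a Coxeter element. As that element fixes only 0, the sum of the set is 0, and
so is every member. -/

/-- A symmetric simply laced generalized Cartan matrix whose quadratic form is positive definite. -/
structure IsPosSimplyLaced {I : Type*} [Fintype I] (C : Matrix I I ℤ) : Prop where
  symm : ∀ i j, C i j = C j i
  diag : ∀ i, C i i = 2
  off : ∀ i j, i ≠ j → C i j = 0 ∨ C i j = -1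
  pos : ∀ x : I → ℤ, x ≠ 0 → 0 < x ⬝ᵥ C *ᵥ x

/-! ### Positive definiteness of the ADE forms -/

section Classification

theorem dotProduct_mulVec_cons {n : ℕ} (M : Matrix (Fin (n + 2)) (Fin (n + 2)) ℤ)
    (N : Matrix (Fin (n + 1)) (Fin (n + 1)) ℤ) (hs : M.IsSymm) (h0 : M 0 0 = 2)
    (h1 : M 0 1 = -1) (h2 : ∀ j : Fin n, M 0 j.succ.succ = 0)
    (hN : ∀ i j : Fin (n + 1), M i.succ j.succ = N i j) (a : ℤ) (y : Fin (n + 1) → ℤ) :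
    (Fin.cons a y : Fin (n + 2) → ℤ) ⬝ᵥ M *ᵥ (Fin.cons a y : Fin (n + 2) → ℤ) =
      2 * a ^ 2 - 2 * a * y 0 + y ⬝ᵥ N *ᵥ y := by
  have e1 : (M *ᵥ (Fin.cons a y : Fin (n + 2) → ℤ)) 0 = 2 * a - y 0 := by
    simp only [mulVec, dotProduct]
    rw [Fin.sum_univ_succ, Fin.sum_univ_succ]
    simp only [Fin.cons_zero, Fin.cons_succ, h0, h2, Fin.succ_zero_eq_one, h1]
    simp
    ring
  have e2 : ∀ i : Fin (n + 1), (M *ᵥ (Fin.cons a y : Fin (n + 2) → ℤ)) i.succ =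
      M i.succ 0 * a + (N *ᵥ y) i := by
    intro i
    simp only [mulVec, dotProduct]
    rw [Fin.sum_univ_succ]
    simp [hN]
  have e3 : ∀ i : Fin n, M i.succ.succ 0 = 0 := fun i => by rw [hs.apply 0]; exact h2 i
  have e4 : M 1 0 = -1 := by rw [hs.apply 0]; exact h1
  rw [dotProduct, Fin.sum_univ_succ]
  simp only [Fin.cons_zero, Fin.cons_succ, e1, e2, mul_add, Finset.sum_add_distrib]
  rw [Fin.sum_univ_succ]
  simp only [Fin.succ_zero_eq_one, e3, e4, dotProduct]
  simp
  ring

/-- Positivity of a form, in the strong form that is inherited when a vertex is attached to the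
vertex `0`. -/
theorem strongPos_cons {n : ℕ} (M : Matrix (Fin (n + 2)) (Fin (n + 2)) ℤ)
    (N : Matrix (Fin (n + 1)) (Fin (n + 1)) ℤ) (hs : M.IsSymm) (h0 : M 0 0 = 2)
    (h1 : M 0 1 = -1) (h2 : ∀ j : Fin n, M 0 j.succ.succ = 0)
    (hN : ∀ i j : Fin (n + 1), M i.succ j.succ = N i j)
    (ih : ∀ y : Fin (n + 1) → ℤ, y 0 ^ 2 ≤ y ⬝ᵥ N *ᵥ y ∧ (y ≠ 0 → 0 < y ⬝ᵥ N *ᵥ y))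
    (x : Fin (n + 2) → ℤ) : x 0 ^ 2 ≤ x ⬝ᵥ M *ᵥ x ∧ (x ≠ 0 → 0 < x ⬝ᵥ M *ᵥ x) := by
  induction x using Fin.consCases with
  | _ a y =>
  rw [dotProduct_mulVec_cons M N hs h0 h1 h2 hN]
  obtain ⟨i1, i2⟩ := ih y
  -- 2a² − 2ay₀ + y₀² = a² + (a − y₀)², so the bound by the square of the end coordinate passes to
  -- the longer leg.
  refine ⟨by simp only [Fin.cons_zero]; nlinarith [sq_nonneg (a - y 0)], fun hne => ?_⟩
  by_cases hy : y = 0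
  · subst hy
    have ha : a ≠ 0 := by
      rintro rfl
      exact hne (by ext i; cases i using Fin.cases <;> simp)
    have := sq_pos_of_ne_zero ha
    simp
    omega
  · have := i2 hy
    by_cases ha : a = 0
    · subst ha; simpa using this
    · have := sq_pos_of_ne_zero ha
      nlinarith [sq_nonneg (a - y 0)]

theorem strongPos_A (n : ℕ) (x : Fin (n + 1) → ℤ) :
    x 0 ^ 2 ≤ x ⬝ᵥ CartanMatrix.A (n + 1) *ᵥ x ∧
      (x ≠ 0 → 0 < x ⬝ᵥ CartanMatrix.A (n + 1) *ᵥ x) := by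
  induction n with
  | zero =>
    have : x ⬝ᵥ CartanMatrix.A (0 + 1) *ᵥ x = 2 * x 0 ^ 2 := by
      simp [CartanMatrix.A, dotProduct, mulVec]; ring
    rw [this]
    refine ⟨by nlinarith [sq_nonneg (x 0)], fun hx => ?_⟩
    have : x 0 ≠ 0 := fun h => hx (by ext i; fin_cases i; exact h)
    have := sq_pos_of_ne_zero this
    omega
  | succ n ih =>
    refine strongPos_cons _ (CartanMatrix.A (n + 1)) (CartanMatrix.A_isSymm _) ?_ ?_ ?_ ?_ ih x
    · simp [CartanMatrix.A]
    · simp [CartanMatrix.A]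
    · intro j; simp [CartanMatrix.A, Fin.ext_iff]
    · intro i j; simp [CartanMatrix.A]

theorem strongPos_D (n : ℕ) (x : Fin (n + 4) → ℤ) :
    x 0 ^ 2 ≤ x ⬝ᵥ CartanMatrix.D (n + 4) *ᵥ x ∧
      (x ≠ 0 → 0 < x ⬝ᵥ CartanMatrix.D (n + 4) *ᵥ x) := by
  induction n with
  | zero =>
    have : x ⬝ᵥ CartanMatrix.D (0 + 4) *ᵥ x =
        x 0 ^ 2 + (x 0 - x 1) ^ 2 + (x 1 - x 2 - x 3) ^ 2 + (x 2 - x 3) ^ 2 := by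
      rw [show CartanMatrix.D (0 + 4) = _ from CartanMatrix.D_four]
      simp [dotProduct, mulVec, Fin.sum_univ_succ]; ring
    rw [this]
    have p1 := sq_nonneg (x 0)
    have p2 := sq_nonneg (x 0 - x 1)
    have p3 := sq_nonneg (x 1 - x 2 - x 3)
    have p4 := sq_nonneg (x 2 - x 3)
    refine ⟨by omega, fun hx => ?_⟩
    by_contra hc
    have q1 : x 0 = 0 := pow_eq_zero_iff (two_ne_zero) |>.1 (by omega)
    have q2 : x 0 - x 1 = 0 := pow_eq_zero_iff (two_ne_zero) |>.1 (by omega)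
    have q3 : x 1 - x 2 - x 3 = 0 := pow_eq_zero_iff (two_ne_zero) |>.1 (by omega)
    have q4 : x 2 - x 3 = 0 := pow_eq_zero_iff (two_ne_zero) |>.1 (by omega)
    exact hx (by ext i; fin_cases i <;> simp <;> omega)
  | succ n ih =>
    refine strongPos_cons _ (CartanMatrix.D (n + 4)) (CartanMatrix.D_isSymm _) ?_ ?_ ?_ ?_ ih x
    · simp [CartanMatrix.D]
    · simp [CartanMatrix.D]
    · intro j
      simp only [CartanMatrix.D, of_apply, Fin.ext_iff, Fin.val_zero, Fin.val_succ]
      grind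
    · intro i j
      simp only [CartanMatrix.D, of_apply, Fin.ext_iff, Fin.val_succ]
      grind

theorem pos_E₈ (x : Fin 8 → ℤ) (hx : x ≠ 0) : 0 < x ⬝ᵥ CartanMatrix.E₈ *ᵥ x := by
  -- Squares are completed from the ends of the three legs towards the branch vertex 3; the factor
  -- 60 clears denominators.
  have : 60 * (x ⬝ᵥ CartanMatrix.E₈ *ᵥ x) =
      30 * (2 * x 7 - x 6) ^ 2 + 10 * (3 * x 6 - 2 * x 5) ^ 2 + 5 * (4 * x 5 - 3 * x 4) ^ 2 +
      3 * (5 * x 4 - 4 * x 3) ^ 2 + 30 * (2 * x 0 - x 2) ^ 2 + 10 * (3 * x 2 - 2 * x 3) ^ 2 +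
      30 * (2 * x 1 - x 3) ^ 2 + 2 * x 3 ^ 2 := by
    simp [CartanMatrix.E₈, dotProduct, mulVec, Fin.sum_univ_succ]
    ring
  by_contra hc
  have p1 := sq_nonneg (2 * x 7 - x 6)
  have p2 := sq_nonneg (3 * x 6 - 2 * x 5)
  have p3 := sq_nonneg (4 * x 5 - 3 * x 4)
  have p4 := sq_nonneg (5 * x 4 - 4 * x 3)
  have p5 := sq_nonneg (2 * x 0 - x 2)
  have p6 := sq_nonneg (3 * x 2 - 2 * x 3)
  have p7 := sq_nonneg (2 * x 1 - x 3)
  have p8 := sq_nonneg (x 3)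
  have q1 : 2 * x 7 - x 6 = 0 := pow_eq_zero_iff (two_ne_zero) |>.1 (by omega)
  have q2 : 3 * x 6 - 2 * x 5 = 0 := pow_eq_zero_iff (two_ne_zero) |>.1 (by omega)
  have q3 : 4 * x 5 - 3 * x 4 = 0 := pow_eq_zero_iff (two_ne_zero) |>.1 (by omega)
  have q4 : 5 * x 4 - 4 * x 3 = 0 := pow_eq_zero_iff (two_ne_zero) |>.1 (by omega)
  have q5 : 2 * x 0 - x 2 = 0 := pow_eq_zero_iff (two_ne_zero) |>.1 (by omega)
  have q6 : 3 * x 2 - 2 * x 3 = 0 := pow_eq_zero_iff (two_ne_zero) |>.1 (by omega)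
  have q7 : 2 * x 1 - x 3 = 0 := pow_eq_zero_iff (two_ne_zero) |>.1 (by omega)
  have q8 : x 3 = 0 := pow_eq_zero_iff (two_ne_zero) |>.1 (by omega)
  exact hx (by ext i; fin_cases i <;> simp <;> omega)

theorem pos_E₇ (x : Fin 7 → ℤ) (hx : x ≠ 0) : 0 < x ⬝ᵥ CartanMatrix.E₇ *ᵥ x := by
  have := pos_E₈ ![x 0, x 1, x 2, x 3, x 4, x 5, x 6, 0] (fun h => hx (by
    ext i
    have := congrFun h i.castSucc
    fin_cases i <;> simpa using this))
  convert this using 1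
  simp [CartanMatrix.E₇, CartanMatrix.E₈, dotProduct, mulVec, Fin.sum_univ_succ]

theorem pos_E₆ (x : Fin 6 → ℤ) (hx : x ≠ 0) : 0 < x ⬝ᵥ CartanMatrix.E₆ *ᵥ x := by
  have := pos_E₇ ![x 0, x 1, x 2, x 3, x 4, x 5, 0] (fun h => hx (by
    ext i
    have := congrFun h i.castSucc
    fin_cases i <;> simpa using this))
  convert this using 1
  simp [CartanMatrix.E₆, CartanMatrix.E₇, dotProduct, mulVec, Fin.sum_univ_succ]

theorem IsPosSimplyLaced.submatrix {I J : Type*} [Fintype I] [Fintype J] {N : Matrix J J ℤ}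
    (h : IsPosSimplyLaced N) (e : I ≃ J) : IsPosSimplyLaced (N.submatrix e e) where
  symm i j := h.symm _ _
  diag i := h.diag _
  off i j hij := h.off _ _ (by simpa using hij)
  pos x hx := by
    have := h.pos (x ∘ e.symm) (fun h0 => hx (by
      ext i
      simpa using congrFun h0 (e i)))
    rw [submatrix_mulVec_equiv]
    convert this using 1
    rw [dotProduct, dotProduct, ← e.sum_comp]
    simp

theorem isPosSimplyLaced_of {n : ℕ} {N : Matrix (Fin n) (Fin n) ℤ} (hs : N.IsSymm)
    (hd : ∀ i, N i i = 2) (ho : N.IsSimplyLaced) (hp : ∀ x, x ≠ 0 → 0 < x ⬝ᵥ N *ᵥ x) :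
    IsPosSimplyLaced N :=
  ⟨fun i j => hs.apply j i, hd, fun _ _ hij => ho hij, hp⟩

theorem IsADE.isPosSimplyLaced {I : Type*} [Fintype I] {C : Matrix I I ℤ} (h : IsADE C) :
    IsPosSimplyLaced C := by
  cases h with
  | typeA n hn e h =>
    obtain ⟨n, rfl⟩ : ∃ m, n = m + 1 := ⟨n - 1, by omega⟩
    exact h ▸ (isPosSimplyLaced_of (CartanMatrix.A_isSymm _)
      (fun i => by simp [CartanMatrix.A]) (CartanMatrix.isSimplyLaced_A _)
      (fun x => (strongPos_A n x).2)).submatrix e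
  | typeD n hn e h =>
    obtain ⟨n, rfl⟩ : ∃ m, n = m + 4 := ⟨n - 4, by omega⟩
    exact h ▸ (isPosSimplyLaced_of (CartanMatrix.D_isSymm _)
      (CartanMatrix.D_diag _) (CartanMatrix.isSimplyLaced_D _)
      (fun x => (strongPos_D n x).2)).submatrix e
  | typeE₆ e h =>
    exact h ▸ (isPosSimplyLaced_of CartanMatrix.E₆_isSymm CartanMatrix.E₆_diag
      CartanMatrix.isSimplyLaced_E₆ pos_E₆).submatrix e
  | typeE₇ e h =>
    exact h ▸ (isPosSimplyLaced_of CartanMatrix.E₇_isSymm CartanMatrix.E₇_diag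
      CartanMatrix.isSimplyLaced_E₇ pos_E₇).submatrix e
  | typeE₈ e h =>
    exact h ▸ (isPosSimplyLaced_of CartanMatrix.E₈_isSymm CartanMatrix.E₈_diag
      CartanMatrix.isSimplyLaced_E₈ pos_E₈).submatrix e

end Classification

/-! ### The Euler form and reflection at a source -/

section Euler

variable {I : Type*}

theorem IsDynkinQuiver.reflect {C : Matrix I I ℤ} {Q : Digraph I} (hQ : IsDynkinQuiver C Q)
    (i : I) : IsDynkinQuiver C (reflect i Q) where
  edge_iff a b := by
    rw [← hQ.edge_iff a b]
    simp only [AdaptedSocle.reflect]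
    tauto
  asymm a b := by
    have h1 := hQ.asymm a b
    have h2 := hQ.asymm b a
    simp only [AdaptedSocle.reflect]
    tauto

theorem reflect_comm (i j : I) (Q : Digraph I) :
    reflect i (reflect j Q) = reflect j (reflect i Q) := by
  ext a b
  simp only [reflect]
  tauto

variable [Fintype I] [DecidableEq I]

open Classical in
/-- The matrix of the Euler form of a quiver. -/
noncomputable def eulerMatrix (Q : Digraph I) : Matrix I I ℤ :=
  of fun a b => (if a = b then 1 else 0) - (if Q.Adj a b then 1 else 0)

/-- The Euler form of a quiver. -/
noncomputable def euler (Q : Digraph I) : (I → ℤ) →ₗ[ℤ] (I → ℤ) →ₗ[ℤ] ℤ :=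
  Matrix.toLinearMap₂' ℤ (eulerMatrix Q)

theorem euler_apply (Q : Digraph I) (x y : I → ℤ) :
    euler Q x y = x ⬝ᵥ eulerMatrix Q *ᵥ y := by
  simp [euler, Matrix.toLinearMap₂'_apply']

variable {C : Matrix I I ℤ} {Q : Digraph I}

theorem simpleReflection_apply (C : Matrix I I ℤ) (i : I) (x : I → ℤ) :
    simpleReflection C i x = x - (C *ᵥ x) i • simpleRoot i := by
  simp [simpleReflection]

theorem eulerMatrix_add_transpose (hC : IsPosSimplyLaced C) (hQ : IsDynkinQuiver C Q) :
    eulerMatrix Q + (eulerMatrix Q)ᵀ = C := by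
  ext a b
  simp only [eulerMatrix, Matrix.add_apply, transpose_apply, of_apply]
  have h1 := hQ.edge_iff a b
  have h2 := hQ.asymm a b
  by_cases hab : a = b
  · subst hab
    have := hC.diag a
    simp_all
  · have := hC.off a b hab
    grind

theorem euler_add_swap (hC : IsPosSimplyLaced C) (hQ : IsDynkinQuiver C Q) (x y : I → ℤ) :
    euler Q x y + euler Q y x = x ⬝ᵥ C *ᵥ y := by
  rw [← eulerMatrix_add_transpose hC hQ, euler_apply, euler_apply, add_mulVec, dotProduct_add,
    mulVec_transpose, dotProduct_comm x (y ᵥ* _), ← dotProduct_mulVec]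

theorem euler_self (hC : IsPosSimplyLaced C) (hQ : IsDynkinQuiver C Q) (x : I → ℤ) :
    x ⬝ᵥ C *ᵥ x = 2 * euler Q x x := by
  rw [← euler_add_swap hC hQ]; ring

theorem euler_self_pos (hC : IsPosSimplyLaced C) (hQ : IsDynkinQuiver C Q) {x : I → ℤ}
    (hx : x ≠ 0) : 0 < euler Q x x := by
  have := hC.pos x hx
  rw [euler_self hC hQ] at this
  omega

theorem simpleRoot_dotProduct (i : I) (x : I → ℤ) : simpleRoot i ⬝ᵥ x = x i := by
  simp [simpleRoot]

theorem euler_simpleRoot_add (hC : IsPosSimplyLaced C) (hQ : IsDynkinQuiver C Q) (i : I)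
    (x : I → ℤ) : euler Q (simpleRoot i) x + euler Q x (simpleRoot i) = (C *ᵥ x) i := by
  rw [euler_add_swap hC hQ, simpleRoot_dotProduct]

theorem euler_of_source {i : I} (hi : IsSource Q i) (x : I → ℤ) :
    euler Q x (simpleRoot i) = x i := by
  rw [euler_apply]
  have : eulerMatrix Q *ᵥ simpleRoot i = simpleRoot i := by
    ext a
    simp only [simpleRoot, mulVec_single_one, Matrix.col_apply, eulerMatrix, of_apply]
    simp [hi a, Pi.single_apply]
  rw [this, dotProduct_comm, simpleRoot_dotProduct]

theorem simpleReflection_apply_self (i : I) (x : I → ℤ) :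
    simpleReflection C i x i = x i - (C *ᵥ x) i := by
  simp [simpleReflection_apply, simpleRoot]

theorem simpleReflection_apply_of_ne {i j : I} (h : j ≠ i) (x : I → ℤ) :
    simpleReflection C i x j = x j := by
  simp [simpleReflection_apply, simpleRoot, h]

/-- With this formula, signs of ⟨α_i, ·⟩ are read off from positivity of reflected vectors. -/
theorem euler_source_left (hC : IsPosSimplyLaced C) (hQ : IsDynkinQuiver C Q) {i : I}
    (hi : IsSource Q i) (x : I → ℤ) :
    euler Q (simpleRoot i) x = - simpleReflection C i x i := by
  have := euler_simpleRoot_add hC hQ i x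
  rw [euler_of_source hi] at this
  rw [simpleReflection_apply_self]
  omega

theorem euler_of_sink {i : I} (hi : ∀ j, ¬ Q.Adj i j) (x : I → ℤ) :
    euler Q (simpleRoot i) x = x i := by
  rw [euler_apply, simpleRoot_dotProduct, mulVec, dotProduct]
  simp [eulerMatrix, hi]

theorem IsSource.sink_reflect {i : I} (hi : IsSource Q i) (j : I) :
    ¬ (reflect i Q).Adj i j := by
  have := hi j
  simp [reflect, this]

theorem mulVec_simpleRoot_self (hC : IsPosSimplyLaced C) (i : I) :
    (C *ᵥ simpleRoot i) i = 2 := by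
  simp [simpleRoot, hC.diag]

theorem simpleReflection_simpleRoot (hC : IsPosSimplyLaced C) (i : I) :
    simpleReflection C i (simpleRoot i) = - simpleRoot i := by
  rw [simpleReflection_apply, mulVec_simpleRoot_self hC]
  ext a
  simp
  ring

theorem simpleReflection_simpleReflection (hC : IsPosSimplyLaced C) (i : I) (x : I → ℤ) :
    simpleReflection C i (simpleReflection C i x) = x := by
  conv_lhs => rw [simpleReflection_apply C i x]
  rw [map_sub, map_smul, simpleReflection_simpleRoot hC, simpleReflection_apply]
  ext a
  simp

theorem dotProduct_mulVec_comm (hC : IsPosSimplyLaced C) (x y : I → ℤ) :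
    x ⬝ᵥ C *ᵥ y = y ⬝ᵥ C *ᵥ x := by
  have : Cᵀ = C := by ext a b; exact hC.symm b a
  conv_rhs => rw [← this, mulVec_transpose, dotProduct_comm, ← dotProduct_mulVec]

theorem form_simpleReflection (hC : IsPosSimplyLaced C) (i : I) (x y : I → ℤ) :
    simpleReflection C i x ⬝ᵥ C *ᵥ simpleReflection C i y = x ⬝ᵥ C *ᵥ y := by
  simp only [simpleReflection_apply, mulVec_sub, mulVec_smul, dotProduct_sub, sub_dotProduct,
    dotProduct_smul, smul_dotProduct, simpleRoot_dotProduct]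
  rw [dotProduct_mulVec_comm hC x (simpleRoot i), simpleRoot_dotProduct, mulVec_simpleRoot_self hC]
  simp only [smul_eq_mul]
  ring

theorem euler_reflect_of_apply_eq_zero {i : I} {x y : I → ℤ} (hx : x i = 0) (hy : y i = 0) :
    euler (reflect i Q) x y = euler Q x y := by
  simp only [euler_apply, dotProduct, mulVec]
  refine Finset.sum_congr rfl fun a _ => ?_
  by_cases ha : a = i
  · subst ha; simp [hx]
  congr 1
  refine Finset.sum_congr rfl fun b _ => ?_
  by_cases hb : b = i
  · subst hb; simp [hy]
  have : (reflect i Q).Adj a b ↔ Q.Adj a b := by simp [reflect, ha, hb]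
  by_cases h : Q.Adj a b
  · simp [eulerMatrix, this.2 h, h]
  · simp [eulerMatrix, mt this.1 h, h]

/-- Split off the component along α_i. Vectors vanishing at i do not see the reversed arrows, and
pairings with α_i are explicit because i is a source before and a sink after. This invariance drives
every induction along an adapted word. -/
theorem euler_reflect (hC : IsPosSimplyLaced C) (hQ : IsDynkinQuiver C Q) {i : I}
    (hi : IsSource Q i) (x y : I → ℤ) :
    euler (reflect i Q) (simpleReflection C i x) (simpleReflection C i y) = euler Q x y := by
  have hQ' := hQ.reflect i
  have hs := hi.sink_reflect
  have decomp : ∀ z : I → ℤ, ∃ z', z' i = 0 ∧ z = z' + z i • simpleRoot i ∧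
      simpleReflection C i z = z' + (- z i - (C *ᵥ z') i) • simpleRoot i := by
    intro z
    refine ⟨z - z i • simpleRoot i, by simp [simpleRoot], by simp, ?_⟩
    rw [simpleReflection_apply, mulVec_sub, mulVec_smul]
    simp only [Pi.sub_apply, Pi.smul_apply, mulVec_simpleRoot_self hC]
    ext a
    simp
    ring
  obtain ⟨x', hx0, hx, hsx⟩ := decomp x
  obtain ⟨y', hy0, hy, hsy⟩ := decomp y
  rw [hsx, hsy]
  conv_rhs => rw [hx, hy]
  have e1 := euler_simpleRoot_add hC hQ i y'
  have e2 := euler_simpleRoot_add hC hQ' i x'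
  have e3 := euler_simpleRoot_add hC hQ' i (simpleRoot i)
  rw [mulVec_simpleRoot_self hC] at e3
  rw [euler_of_source hi, hy0] at e1
  rw [euler_of_sink hs, hx0] at e2
  simp only [map_add, map_smul, LinearMap.add_apply, LinearMap.smul_apply, smul_eq_mul,
    euler_reflect_of_apply_eq_zero hx0 hy0, euler_of_source hi, euler_of_sink hs, hx0, hy0]
  have e4 : euler Q (simpleRoot i) y' = (C *ᵥ y') i := by omega
  have e5 : euler (reflect i Q) x' (simpleRoot i) = (C *ᵥ x') i := by omega
  have e6 : simpleRoot i i = 1 := by simp [simpleRoot]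
  rw [e4, e5, e6]
  ring

end Euler

/-! ### Positive roots as vectors of norm 2 -/

section Roots

variable {I : Type*} [Fintype I] [DecidableEq I] {C : Matrix I I ℤ} {Q : Digraph I}

/-- Positive roots, described as the nonnegative vectors on which the form takes the value `2`. -/
def IsPosRoot (C : Matrix I I ℤ) (x : I → ℤ) : Prop := 0 ≤ x ∧ x ⬝ᵥ C *ᵥ x = 2

theorem IsPosRoot.euler_self (hC : IsPosSimplyLaced C) (hQ : IsDynkinQuiver C Q) {x : I → ℤ}
    (hx : IsPosRoot C x) : euler Q x x = 1 := by
  have := AdaptedSocle.euler_self hC hQ x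
  rw [hx.2] at this
  omega

theorem simpleRoot_nonneg (i : I) : 0 ≤ simpleRoot i := by
  simp [simpleRoot]

theorem isPosRoot_simpleRoot (hC : IsPosSimplyLaced C) (i : I) : IsPosRoot C (simpleRoot i) :=
  ⟨simpleRoot_nonneg i, by rw [simpleRoot_dotProduct, mulVec_simpleRoot_self hC]⟩

theorem IsPosRoot.ne_zero {x : I → ℤ} (hx : IsPosRoot C x) : x ≠ 0 := by
  rintro rfl
  have := hx.2
  simp at this

/-- The positive and negative parts have disjoint supports, so their pairing is at most 0. The form
is even and positive, so two nonzero parts would give norm at least 4. -/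
theorem nonneg_or_nonpos (hC : IsPosSimplyLaced C) (hQ : IsDynkinQuiver C Q) {x : I → ℤ}
    (hx : x ⬝ᵥ C *ᵥ x = 2) : 0 ≤ x ∨ x ≤ 0 := by
  set p : I → ℤ := fun a => max (x a) 0 with hp
  set n : I → ℤ := fun a => max (-x a) 0 with hn
  have hxpn : x = p - n := by
    ext a
    simp only [hp, hn, Pi.sub_apply]
    omega
  have hcross : p ⬝ᵥ C *ᵥ n ≤ 0 := by
    simp only [dotProduct, mulVec, Finset.mul_sum]
    refine Finset.sum_nonpos fun a _ => Finset.sum_nonpos fun b _ => ?_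
    by_cases hab : a = b
    · subst hab
      rcases le_total (x a) 0 with h | h
      · simp [hp, h]
      · simp [hn, h]
    · have h1 : 0 ≤ p a := le_max_right _ _
      have h2 : 0 ≤ n b := le_max_right _ _
      have h3 : C a b ≤ 0 := by rcases hC.off a b hab with h | h <;> omega
      rw [mul_left_comm]
      exact mul_nonpos_of_nonpos_of_nonneg h3 (mul_nonneg h1 h2)
  have hsum : x ⬝ᵥ C *ᵥ x = p ⬝ᵥ C *ᵥ p + n ⬝ᵥ C *ᵥ n - 2 * (p ⬝ᵥ C *ᵥ n) := by
    conv_lhs => rw [hxpn]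
    rw [mulVec_sub, dotProduct_sub, sub_dotProduct, sub_dotProduct, dotProduct_mulVec_comm hC n p]
    ring
  rw [hx, euler_self hC hQ, euler_self hC hQ] at hsum
  by_contra hcon
  push Not at hcon
  have hp0 : p ≠ 0 := fun h => hcon.2 fun a => by
    have := congrFun h a
    simp only [hp, Pi.zero_apply] at this
    simp only [Pi.zero_apply]
    omega
  have hn0 : n ≠ 0 := fun h => hcon.1 fun a => by
    have := congrFun h a
    simp only [hn, Pi.zero_apply] at this
    simp only [Pi.zero_apply]
    omega
  have h1 := euler_self_pos hC hQ hp0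
  have h2 := euler_self_pos hC hQ hn0
  omega

theorem IsPosRoot.simpleReflection (hC : IsPosSimplyLaced C) (hQ : IsDynkinQuiver C Q) {i : I}
    {x : I → ℤ} (hx : IsPosRoot C x) (hne : x ≠ simpleRoot i) :
    IsPosRoot C (simpleReflection C i x) := by
  have h2 : AdaptedSocle.simpleReflection C i x ⬝ᵥ C *ᵥ AdaptedSocle.simpleReflection C i x = 2 := by
    rw [form_simpleReflection hC, hx.2]
  refine ⟨(nonneg_or_nonpos hC hQ h2).resolve_right fun hneg => hne ?_, h2⟩
  have hxi : x = x i • simpleRoot i := by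
    ext a
    by_cases ha : a = i
    · subst ha; simp [simpleRoot]
    · have h3 := hneg a
      rw [simpleReflection_apply_of_ne ha] at h3
      have h4 := hx.1 a
      simp only [Pi.zero_apply] at h3 h4
      simp [simpleRoot, ha]
      omega
  have h4 := hx.1 i
  have h5 := hx.2
  rw [hxi, mulVec_smul, dotProduct_smul, smul_dotProduct, simpleRoot_dotProduct,
    mulVec_simpleRoot_self hC] at h5
  simp only [smul_eq_mul] at h5
  simp only [Pi.zero_apply] at h4
  have : x i = 1 := by nlinarith
  rw [hxi, this, one_smul]

end Roots

/-! ### Roots of reduced and adapted words -/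

section WordLemmas

variable {I : Type*} [Fintype I] [DecidableEq I] {C : Matrix I I ℤ} {Q : Digraph I}

theorem wordProd_nil (x : I → ℤ) : wordProd C [] x = x := rfl

theorem wordProd_cons (i : I) (l : List I) (x : I → ℤ) :
    wordProd C (i :: l) x = simpleReflection C i (wordProd C l x) := by
  simp [wordProd]

theorem wordProd_append (u v : List I) (x : I → ℤ) :
    wordProd C (u ++ v) x = wordProd C u (wordProd C v x) := by
  simp [wordProd]

/-- The list of roots `β₁, …, β_t` of a word. -/
def rootList (C : Matrix I I ℤ) : List I → List (I → ℤ)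
  | [] => []
  | i :: l => simpleRoot i :: (rootList C l).map (simpleReflection C i)

theorem rootList_append (u v : List I) :
    rootList C (u ++ v) = rootList C u ++ (rootList C v).map (wordProd C u) := by
  induction u with
  | nil => exact (List.map_id _).symm
  | cons i u ih =>
    simp only [List.cons_append, rootList, ih, List.map_append, List.map_map]
    congr 2

theorem length_rootList (l : List I) : (rootList C l).length = l.length := by
  induction l with
  | nil => rfl
  | cons i l ih => simp [rootList, ih]

theorem wordRoot_eq_getElem (l : List I) (k : Fin l.length) :
    wordRoot C l k = (rootList C l)[k.1]'(by rw [length_rootList]; exact k.2) := by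
  induction l with
  | nil => exact k.elim0
  | cons i l ih =>
    cases k using Fin.cases with
    | zero => simp [wordRoot, rootList, wordProd]
    | succ k =>
      have := ih k
      simp only [wordRoot, Fin.val_succ, List.take_succ_cons, wordProd_cons, rootList,
        List.getElem_cons_succ, List.getElem_map] at this ⊢
      rw [← this]
      rfl

theorem mem_wordRoots {l : List I} {x : I → ℤ} : x ∈ wordRoots C l ↔ x ∈ rootList C l := by
  rw [List.mem_iff_getElem]
  constructor
  · rintro ⟨k, rfl⟩
    exact ⟨k, by rw [length_rootList]; exact k.2, (wordRoot_eq_getElem l k).symm⟩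
  · rintro ⟨k, hk, rfl⟩
    exact ⟨⟨k, by rwa [length_rootList] at hk⟩, wordRoot_eq_getElem l _⟩

theorem mem_rootList {l : List I} {x : I → ℤ} :
    x ∈ rootList C l ↔ ∃ u j r, l = u ++ j :: r ∧ x = wordProd C u (simpleRoot j) := by
  induction l generalizing x with
  | nil => simp [rootList]
  | cons i l ih =>
    simp only [rootList, List.mem_cons, List.mem_map]
    constructor
    · rintro (rfl | ⟨y, hy, rfl⟩)
      · exact ⟨[], i, l, rfl, rfl⟩
      · obtain ⟨u, j, r, rfl, rfl⟩ := ih.1 hy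
        exact ⟨i :: u, j, r, rfl, (wordProd_cons _ _ _).symm⟩
    · rintro ⟨u, j, r, h, rfl⟩
      cases u with
      | nil =>
        simp only [List.nil_append, List.cons.injEq] at h
        exact Or.inl (by rw [h.1]; rfl)
      | cons i' u =>
        simp only [List.cons_append, List.cons.injEq] at h
        obtain ⟨rfl, h⟩ := h
        exact Or.inr ⟨_, ih.2 ⟨u, j, r, h, rfl⟩, (wordProd_cons _ _ _).symm⟩

theorem IsReduced.tail {i : I} {l : List I} (h : IsReduced C (i :: l)) : IsReduced C l := by
  intro l' hl'
  have := h (i :: l') (LinearMap.ext fun x => by rw [wordProd_cons, wordProd_cons, hl'])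
  simpa using this

theorem IsReduced.of_append {u l : List I} (h : IsReduced C (u ++ l)) : IsReduced C l := by
  induction u with
  | nil => exact h
  | cons i u ih => exact ih h.tail

theorem form_wordProd (hC : IsPosSimplyLaced C) (u : List I) (x y : I → ℤ) :
    wordProd C u x ⬝ᵥ C *ᵥ wordProd C u y = x ⬝ᵥ C *ᵥ y := by
  induction u with
  | nil => rfl
  | cons i u ih => rw [wordProd_cons, wordProd_cons, form_simpleReflection hC, ih]

theorem exists_eq_simpleRoot (hC : IsPosSimplyLaced C) (hQ : IsDynkinQuiver C Q) (u : List I)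
    {x : I → ℤ} (hx : IsPosRoot C x) (hu : ¬ IsPosRoot C (wordProd C u x)) :
    ∃ u₁ i u₂, u = u₁ ++ i :: u₂ ∧ wordProd C u₂ x = simpleRoot i := by
  induction u with
  | nil => exact absurd hx hu
  | cons i u ih =>
    by_cases h : IsPosRoot C (wordProd C u x)
    · refine ⟨[], i, u, rfl, by_contra fun hne => hu ?_⟩
      rw [wordProd_cons]
      exact h.simpleReflection hC hQ hne
    · obtain ⟨u₁, k, u₂, rfl, h2⟩ := ih h
      exact ⟨i :: u₁, k, u₂, rfl, h2⟩

/-- Exchange argument: a root that is not positive must have passed through some simple root α_i,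
and then two letters of the word can be deleted. -/
theorem IsReduced.isPosRoot (hC : IsPosSimplyLaced C) (hQ : IsDynkinQuiver C Q) {l : List I}
    (hl : IsReduced C l) {x : I → ℤ} (hx : x ∈ rootList C l) : IsPosRoot C x := by
  obtain ⟨u, j, r, rfl, rfl⟩ := mem_rootList.1 hx
  by_contra hneg
  obtain ⟨u₁, i, u₂, rfl, h2⟩ := exists_eq_simpleRoot hC hQ u (isPosRoot_simpleRoot hC j) hneg
  have key : ∀ y, simpleReflection C i (wordProd C u₂ y) =
      wordProd C u₂ (simpleReflection C j y) := by
    intro y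
    rw [simpleReflection_apply, simpleReflection_apply, map_sub, map_smul, h2]
    congr 2
    rw [← simpleRoot_dotProduct i (C *ᵥ _), ← h2, form_wordProd hC, simpleRoot_dotProduct]
  have := hl (u₁ ++ u₂ ++ r) (LinearMap.ext fun y => by
    simp only [wordProd_append, wordProd_cons, key]
    rw [simpleReflection_simpleReflection hC])
  simp at this

/-- For the first letter i, a source, ⟨y, α_i⟩ = y_i and ⟨α_i, y⟩ = −(s_i y)_i, where y and s_i y
are both positive roots. The other pairs follow by reflecting at i. -/
theorem pairwise_rootList (hC : IsPosSimplyLaced C) {l : List I} (hQ : IsDynkinQuiver C Q)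
    (hl : IsReduced C l) (ha : IsAdapted Q l) :
    (rootList C l).Pairwise fun x y => 0 ≤ euler Q y x ∧ euler Q x y ≤ 0 := by
  induction l generalizing Q with
  | nil => exact List.Pairwise.nil
  | cons i l ih =>
    obtain ⟨hi, ha⟩ := ha
    refine List.Pairwise.cons (fun y hy => ?_) (List.pairwise_map.2 ?_)
    · have hy1 : IsPosRoot C y := hl.isPosRoot hC hQ (List.mem_cons_of_mem _ hy)
      obtain ⟨x, hx, rfl⟩ := List.mem_map.1 hy
      have hx1 := hl.tail.isPosRoot hC hQ hx
      rw [euler_of_source hi, euler_source_left hC hQ hi, simpleReflection_simpleReflection hC]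
      have h1 := hy1.1 i
      have h2 := hx1.1 i
      simp only [Pi.zero_apply] at h1 h2
      omega
    · refine (ih (hQ.reflect i) hl.tail ha).imp fun {x y} h => ?_
      have e := fun x y => euler_reflect hC hQ hi (simpleReflection C i x) (simpleReflection C i y)
      simp only [simpleReflection_simpleReflection hC] at e
      rwa [← e, ← e]

theorem simpleReflection_comm (hC : IsPosSimplyLaced C) {i j : I} (h : C i j = 0) (x : I → ℤ) :
    simpleReflection C i (simpleReflection C j x) =
      simpleReflection C j (simpleReflection C i x) := by
  have h' : C j i = 0 := by rw [hC.symm]; exact h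
  have e1 : (C *ᵥ simpleRoot j) i = 0 := by simp [simpleRoot, h]
  have e2 : (C *ᵥ simpleRoot i) j = 0 := by simp [simpleRoot, h']
  simp only [simpleReflection_apply, mulVec_sub, mulVec_smul, Pi.sub_apply, Pi.smul_apply, e1, e2]
  simp only [smul_zero, sub_zero]
  abel

theorem isAdapted_swap (hQ : IsDynkinQuiver C Q) {i j : I} (h : C i j = 0) (u v : List I)
    (ha : IsAdapted Q (u ++ i :: j :: v)) : IsAdapted Q (u ++ j :: i :: v) := by
  induction u generalizing Q with
  | cons k u ih => exact ⟨ha.1, ih (hQ.reflect k) ha.2⟩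
  | nil =>
    obtain ⟨hi, hj, hv⟩ := ha
    have e1 : ¬ Q.Adj i j := fun e => ((hQ.edge_iff i j).1 (Or.inl e)).2 h
    have e2 : ¬ Q.Adj j i := fun e => ((hQ.edge_iff i j).1 (Or.inr e)).2 h
    refine ⟨fun k hk => ?_, fun k hk => ?_, by rwa [reflect_comm]⟩
    · have := hj k
      have := hi k
      simp only [reflect] at *
      grind
    · have := hi k
      have := hj k
      simp only [reflect] at *
      grind

/-- Transports sign statements about `l` to every word of its class, as the order on sequences
demands. -/
theorem CommEquiv.invariants (hC : IsPosSimplyLaced C) (hQ : IsDynkinQuiver C Q) {l l' : List I}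
    (h : CommEquiv C l l') : (IsAdapted Q l ↔ IsAdapted Q l') ∧ l.length = l'.length ∧
      wordProd C l = wordProd C l' ∧ (rootList C l).Perm (rootList C l') := by
  induction h with
  | refl l => exact ⟨Iff.rfl, rfl, rfl, List.Perm.refl _⟩
  | symm l l' _ ih => exact ⟨ih.1.symm, ih.2.1.symm, ih.2.2.1.symm, ih.2.2.2.symm⟩
  | trans _ _ _ _ _ h1 h2 =>
    exact ⟨h1.1.trans h2.1, h1.2.1.trans h2.2.1, h1.2.2.1.trans h2.2.2.1, h1.2.2.2.trans h2.2.2.2⟩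
  | rel l l' h =>
    obtain ⟨u, v, i, j, h⟩ := h
    have h' : C j i = 0 := by rw [hC.symm]; exact h
    refine ⟨⟨isAdapted_swap hQ h u v, isAdapted_swap hQ h' u v⟩, by simp,
      LinearMap.ext fun x => ?_, ?_⟩
    · simp only [wordProd_append, wordProd_cons, simpleReflection_comm hC h]
    · rw [rootList_append, rootList_append]
      refine List.Perm.append_left _ (List.Perm.map _ ?_)
      have e1 : simpleReflection C i (simpleRoot j) = simpleRoot j := by
        rw [simpleReflection_apply]; simp [simpleRoot, h]
      have e2 : simpleReflection C j (simpleRoot i) = simpleRoot i := by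
        rw [simpleReflection_apply]; simp [simpleRoot, h']
      have e3 : (simpleReflection C i : (I → ℤ) → _) ∘ simpleReflection C j =
          simpleReflection C j ∘ simpleReflection C i :=
        funext fun x => simpleReflection_comm hC h x
      simp only [rootList, List.map_cons, e1, e2, List.map_map, e3]
      exact List.Perm.swap _ _ _

theorem IsReduced.of_commEquiv (hC : IsPosSimplyLaced C) (hQ : IsDynkinQuiver C Q) {l l' : List I}
    (h : CommEquiv C l l') (hl : IsReduced C l) : IsReduced C l' := by
  obtain ⟨-, h1, h2, -⟩ := h.invariants hC hQ
  intro m hm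
  rw [← h1]
  exact hl m (hm.trans h2.symm)

/-- A positive root that pairs positively with the last root of an adapted word on the left
occurs among the roots of the word. -/
theorem mem_rootList_of_euler_pos (hC : IsPosSimplyLaced C) (hQ : IsDynkinQuiver C Q)
    (v : List I) (j : I) (ha : IsAdapted Q (v ++ [j])) {x : I → ℤ} (hx : IsPosRoot C x)
    (he : 0 < euler Q (wordProd C v (simpleRoot j)) x) : x ∈ rootList C (v ++ [j]) := by
  induction v generalizing Q x with
  | nil =>
    by_contra hmem
    have hne : x ≠ simpleRoot j := by simpa [rootList] using hmem
    have := (hx.simpleReflection hC hQ hne).1 j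
    -- ⟨α_j, x⟩ = −(s_j x)_j is at most 0 for every positive root x other than α_j.
    rw [wordProd_nil, euler_source_left hC hQ ha.1] at he
    simp only [Pi.zero_apply] at this
    omega
  | cons i v ih =>
    obtain ⟨hi, ha⟩ := ha
    by_cases hne : x = simpleRoot i
    · subst hne
      exact List.mem_cons_self
    · have h1 := ih (hQ.reflect i) ha (hx.simpleReflection hC hQ hne) (by
        rw [← euler_reflect hC hQ hi, wordProd_cons, simpleReflection_simpleReflection hC] at he
        exact he)
      exact List.mem_cons_of_mem _
        (List.mem_map.2 ⟨_, h1, simpleReflection_simpleReflection hC i x⟩)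

end WordLemmas

/-! ### Finitely many lattice vectors of bounded norm -/

section Finiteness

variable {I : Type*} [Fintype I] [DecidableEq I] {C : Matrix I I ℤ}

theorem IsPosSimplyLaced.form_nonneg (hC : IsPosSimplyLaced C) (x : I → ℤ) :
    0 ≤ x ⬝ᵥ C *ᵥ x := by
  by_cases hx : x = 0
  · simp [hx]
  · exact (hC.pos x hx).le

theorem form_cauchy_schwarz (hC : IsPosSimplyLaced C) (x : I → ℤ) {y : I → ℤ} (hy : y ≠ 0) :
    (x ⬝ᵥ C *ᵥ y) ^ 2 ≤ (x ⬝ᵥ C *ᵥ x) * (y ⬝ᵥ C *ᵥ y) := by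
  have h1 := hC.pos y hy
  have h2 := hC.form_nonneg ((y ⬝ᵥ C *ᵥ y) • x - (x ⬝ᵥ C *ᵥ y) • y)
  simp only [mulVec_sub, mulVec_smul, dotProduct_sub, sub_dotProduct, dotProduct_smul,
    smul_dotProduct, smul_eq_mul, dotProduct_mulVec_comm hC y x] at h2
  by_contra hcon
  push Not at hcon
  nlinarith

theorem IsPosSimplyLaced.det_ne_zero (hC : IsPosSimplyLaced C) : C.det ≠ 0 := fun h => by
  obtain ⟨v, hv, h0⟩ := Matrix.exists_mulVec_eq_zero_iff.2 h
  have := hC.pos v hv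
  simp [h0] at this

theorem finite_form_le (hC : IsPosSimplyLaced C) (N : ℤ) :
    {x : I → ℤ | x ⬝ᵥ C *ᵥ x ≤ N}.Finite := by
  have key : ∀ i : I, ∃ B : ℤ, ∀ x : I → ℤ, x ⬝ᵥ C *ᵥ x ≤ N → |x i| ≤ B := by
    intro i
    -- Pairing with y extracts the i-th coordinate up to the factor det C, so Cauchy–Schwarz bounds
    -- that coordinate.
    set y := C.adjugate *ᵥ Pi.single i 1 with hy
    have hCy : C *ᵥ y = C.det • Pi.single i 1 := by
      rw [hy, mulVec_mulVec, mul_adjugate, smul_mulVec, one_mulVec]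
    have hy0 : y ≠ 0 := by
      intro h0
      rw [h0, mulVec_zero] at hCy
      have := congrFun hCy i
      simp at this
      exact hC.det_ne_zero this.symm
    refine ⟨N * (y ⬝ᵥ C *ᵥ y), fun x hx => ?_⟩
    have h1 := form_cauchy_schwarz hC x hy0
    have h2 : x ⬝ᵥ C *ᵥ y = C.det * x i := by
      rw [hCy, dotProduct_smul]; simp
    rw [h2] at h1
    have h3 : 1 ≤ C.det ^ 2 := by
      have := sq_pos_of_ne_zero hC.det_ne_zero
      omega
    have h4 := hC.pos y hy0
    have h5 : |x i| ≤ x i ^ 2 := by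
      rw [← sq_abs]
      exact Int.le_self_sq _
    have h6 : x i ^ 2 ≤ C.det ^ 2 * x i ^ 2 := le_mul_of_one_le_left (sq_nonneg _) h3
    rw [mul_pow] at h1
    exact h5.trans (h6.trans (h1.trans (mul_le_mul_of_nonneg_right hx h4.le)))
  choose B hB using key
  refine (Set.finite_Icc (fun i => - B i) B).subset fun x hx => ⟨fun i => ?_, fun i => ?_⟩
  · exact (abs_le.1 (hB i x hx)).1
  · exact (abs_le.1 (hB i x hx)).2

end Finiteness

/-! ### Coxeter elements and their fixed vectors -/

section Coxeter

variable {I : Type*} [Fintype I] [DecidableEq I] {C : Matrix I I ℤ} {Q : Digraph I}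

/-- Otherwise every vertex of S receives an arrow from S, and the indicator vector of S has Euler
norm at most 0. -/
theorem exists_source (hC : IsPosSimplyLaced C) (hQ : IsDynkinQuiver C Q) {S : Finset I}
    (hS : S.Nonempty) : ∃ i ∈ S, ∀ a ∈ S, ¬ Q.Adj a i := by
  classical
  by_contra hcon
  push Not at hcon
  set x : I → ℤ := fun a => if a ∈ S then 1 else 0 with hx
  have hx0 : x ≠ 0 := by
    obtain ⟨i, hi⟩ := hS
    intro h
    have := congrFun h i
    simp [hx, hi] at this
  have h1 := euler_self_pos hC hQ hx0
  rw [euler_apply, dotProduct_mulVec, dotProduct] at h1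
  refine absurd h1 (not_lt.2 (Finset.sum_nonpos fun b _ => ?_))
  by_cases hb : b ∈ S
  · obtain ⟨a, ha, hab⟩ := hcon b hb
    have : (x ᵥ* eulerMatrix Q) b = 1 - ∑ a ∈ S, (if Q.Adj a b then 1 else 0) := by
      simp only [vecMul, dotProduct, hx, eulerMatrix, of_apply, ite_mul, one_mul, zero_mul,
        Finset.sum_ite_mem, Finset.univ_inter, Finset.sum_sub_distrib]
      simp [hb]
    rw [this]
    have h2 := Finset.single_le_sum (f := fun a => if Q.Adj a b then (1 : ℤ) else 0)
      (fun a _ => by positivity) ha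
    simp only [hab, if_true] at h2
    simp only [hx, hb, if_true]
    omega
  · simp [hx, hb]

/-- Reverse all arrows between `D` and its complement. -/
def flipCut (D : Finset I) (Q : Digraph I) : Digraph I where
  Adj a b := ((a ∈ D ↔ b ∈ D) ∧ Q.Adj a b) ∨ (¬ (a ∈ D ↔ b ∈ D) ∧ Q.Adj b a)

theorem reflect_flipCut {D : Finset I} {i : I} (hi : i ∉ D) :
    reflect i (flipCut D Q) = flipCut (insert i D) Q := by
  ext a b
  simp only [reflect, flipCut, Finset.mem_insert]
  by_cases ha : a = i <;> by_cases hb : b = i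
  · subst ha; subst hb; simp
  · subst ha; simp [hb, hi]; tauto
  · subst hb; simp [ha, hi]; tauto
  · simp [ha, hb]

/-- D holds the vertices already reflected. An arrow inside D has been reversed twice and an arrow
across the cut once, which is `flipCut D Q`; once D is everything, Q is back. -/
theorem exists_adapted_completion (hC : IsPosSimplyLaced C) (hQ : IsDynkinQuiver C Q) (n : ℕ)
    (D : Finset I) (hn : Dᶜ.card = n) (hD : ∀ a ∉ D, ∀ b ∈ D, ¬ Q.Adj a b) :
    ∃ L : List I, L.Nodup ∧ (∀ x, x ∈ L ↔ x ∉ D) ∧ IsAdapted (flipCut D Q) L ∧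
      L.foldl (fun R i => reflect i R) (flipCut D Q) = Q := by
  induction n generalizing D with
  | zero =>
    rw [Finset.card_eq_zero, Finset.compl_eq_empty_iff] at hn
    subst hn
    exact ⟨[], List.nodup_nil, by simp, trivial, by ext; simp [flipCut]⟩
  | succ n ih =>
    obtain ⟨i, hi, hsrc⟩ := exists_source hC hQ (S := Dᶜ) (by
      rw [← Finset.card_pos]; omega)
    rw [Finset.mem_compl] at hi
    simp only [Finset.mem_compl] at hsrc
    obtain ⟨L, h1, h2, h3, h4⟩ := ih (insert i D)
      (by rw [Finset.card_compl, Finset.card_insert_of_notMem hi]; rw [Finset.card_compl] at hn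
          omega)
      (fun a ha b hb => by
        simp only [Finset.mem_insert, not_or] at ha hb
        rcases hb with rfl | hb
        · exact hsrc a ha.2
        · exact hD a ha.2 b hb)
    refine ⟨i :: L, List.nodup_cons.2 ⟨by simp [h2], h1⟩, fun x => ?_, ⟨fun a => ?_, ?_⟩, ?_⟩
    · simp only [List.mem_cons, h2, Finset.mem_insert]
      by_cases hx : x = i <;> simp [hx, hi]
    · simp only [flipCut]
      have h5 := hsrc a
      have h6 := hD i hi a
      tauto
    · rwa [reflect_flipCut hi]
    · rwa [List.foldl_cons, reflect_flipCut hi]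

/-- A Dynkin quiver has an adapted enumeration of its vertices along which it reflects to
itself. -/
theorem exists_coxeter_word (hC : IsPosSimplyLaced C) (hQ : IsDynkinQuiver C Q) :
    ∃ L : List I, L.Nodup ∧ (∀ x, x ∈ L) ∧ IsAdapted Q L ∧
      L.foldl (fun R i => reflect i R) Q = Q := by
  obtain ⟨L, h1, h2, h3, h4⟩ := exists_adapted_completion hC hQ _ ∅ rfl (by simp)
  have : flipCut ∅ Q = Q := by ext; simp [flipCut]
  rw [this] at h3 h4
  exact ⟨L, h1, by simpa using h2, h3, h4⟩

theorem wordProd_apply_of_notMem {L : List I} {i : I} (hi : i ∉ L) (x : I → ℤ) :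
    wordProd C L x i = x i := by
  induction L with
  | nil => rfl
  | cons j L ih =>
    simp only [List.mem_cons, not_or] at hi
    rw [wordProd_cons, simpleReflection_apply_of_ne hi.1, ih hi.2]

/-- Only the letter i alters coordinate i, and it occurs once; so a fixed vector is fixed by each
simple reflection separately. -/
theorem mulVec_eq_zero_of_wordProd_eq {L : List I} (hL : L.Nodup) {x : I → ℤ}
    (hx : wordProd C L.reverse x = x) : ∀ i ∈ L, (C *ᵥ x) i = 0 := by
  induction L with
  | nil => simp
  | cons i L ih =>
    rw [List.nodup_cons] at hL
    rw [List.reverse_cons, wordProd_append, wordProd_cons, wordProd_nil] at hx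
    have h1 := congrFun hx i
    rw [wordProd_apply_of_notMem (by simpa using hL.1), simpleReflection_apply_self] at h1
    have h2 : (C *ᵥ x) i = 0 := by omega
    have h3 : simpleReflection C i x = x := by
      rw [simpleReflection_apply, h2]; simp
    rw [h3] at hx
    intro j hj
    rcases List.mem_cons.1 hj with rfl | hj
    · exact h2
    · exact ih hL.2 hx j hj

theorem wordProd_injective (hC : IsPosSimplyLaced C) (L : List I) :
    Function.Injective (wordProd C L) := by
  induction L with
  | nil => exact fun _ _ h => h
  | cons i L ih =>
    intro x y h
    rw [wordProd_cons, wordProd_cons] at h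
    apply ih
    rw [← simpleReflection_simpleReflection hC i (wordProd C L x), h,
      simpleReflection_simpleReflection hC]

theorem closed_under_adapted {B : Digraph I → (I → ℤ) → Prop}
    (hB : ∀ R x i, B R x → IsSource R i → B (reflect i R) (simpleReflection C i x))
    (L : List I) {R : Digraph I} {x : I → ℤ} (hL : IsAdapted R L) (h : B R x) :
    B (L.foldl (fun R i => reflect i R) R) (wordProd C L.reverse x) := by
  induction L generalizing R x with
  | nil => exact h
  | cons i L ih =>
    rw [List.reverse_cons, wordProd_append]
    exact ih hL.2 (hB _ _ _ h hL.1)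

/-- A family of nonnegative vectors of bounded norm that is stable under reflections at sources
contains at most the zero vector. -/
theorem eq_zero_of_closed (hC : IsPosSimplyLaced C) {B : Digraph I → (I → ℤ) → Prop} {N : ℤ}
    (hB : ∀ R x i, B R x → IsSource R i → B (reflect i R) (simpleReflection C i x))
    (hB0 : ∀ R x, B R x → 0 ≤ x) (hBN : ∀ R x, B R x → x ⬝ᵥ C *ᵥ x ≤ N)
    (hQ : IsDynkinQuiver C Q) {x : I → ℤ} (hx : B Q x) : x = 0 := by
  classical
  obtain ⟨L, h1, h2, h3, h4⟩ := exists_coxeter_word hC hQ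
  have hfin : {y | B Q y}.Finite := (finite_form_le hC N).subset fun y hy => hBN Q y hy
  set S := hfin.toFinset with hS
  have hmem : ∀ y, y ∈ S ↔ B Q y := fun y => by simp [hS]
  have himg : S.image (wordProd C L.reverse) = S := by
    refine Finset.eq_of_subset_of_card_le (fun y hy => ?_) ?_
    · obtain ⟨z, hz, rfl⟩ := Finset.mem_image.1 hy
      have := closed_under_adapted hB L h3 ((hmem z).1 hz)
      rw [h4] at this
      exact (hmem _).2 this
    · rw [Finset.card_image_of_injective _ (wordProd_injective hC _)]
  have hsum : wordProd C L.reverse (∑ y ∈ S, y) = ∑ y ∈ S, y := by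
    rw [map_sum]
    conv_rhs => rw [← himg]
    rw [Finset.sum_image (fun _ _ _ _ h => wordProd_injective hC _ h)]
  have hzero : C *ᵥ (∑ y ∈ S, y) = 0 :=
    funext fun i => mulVec_eq_zero_of_wordProd_eq h1 hsum i (h2 i)
  have hX : ∑ y ∈ S, y = 0 := by
    by_contra hne
    have := hC.pos _ hne
    simp [hzero] at this
  have hle := Finset.single_le_sum (f := fun y : I → ℤ => y)
    (fun y hy => hB0 Q y ((hmem y).1 hy)) ((hmem x).2 hx)
  rw [hX] at hle
  exact le_antisymm hle (hB0 Q x hx)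

end Coxeter

/-! ### Rigid decompositions of nonnegative vectors -/

section Decomposition

variable {I : Type*} [Fintype I] [DecidableEq I] {C : Matrix I I ℤ} {Q : Digraph I}

/-- `s` is a decomposition of `v` into positive roots on which the Euler form of `Q` is
nonnegative; these are the dimension vectors of the summands of a rigid representation. -/
structure IsRigidDecomp (C : Matrix I I ℤ) (Q : Digraph I) (v : I → ℤ) (s : Multiset (I → ℤ)) :
    Prop where
  isPosRoot : ∀ x ∈ s, IsPosRoot C x
  sum_eq : s.sum = v
  euler_nonneg : ∀ x ∈ s, ∀ y ∈ s, 0 ≤ euler Q x y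

theorem IsRigidDecomp.le {v x : I → ℤ} {s : Multiset (I → ℤ)} (h : IsRigidDecomp C Q v s)
    (hx : x ∈ s) : x ≤ v :=
  h.sum_eq ▸ Multiset.single_le_sum (fun y hy => (h.isPosRoot y hy).1) x hx

theorem IsRigidDecomp.one_le_left (hC : IsPosSimplyLaced C) (hQ : IsDynkinQuiver C Q)
    {v x : I → ℤ} {s : Multiset (I → ℤ)} (h : IsRigidDecomp C Q v s) (hx : x ∈ s) :
    1 ≤ euler Q v x := by
  obtain ⟨t, rfl⟩ := Multiset.exists_cons_of_mem hx
  rw [← h.sum_eq, Multiset.sum_cons, map_add, LinearMap.add_apply,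
    (h.isPosRoot x hx).euler_self hC hQ]
  have : euler Q t.sum x = (t.map fun y => euler Q y x).sum :=
    map_multiset_sum ((euler Q).flip x) t
  rw [this]
  have := Multiset.sum_nonneg (s := t.map fun y => euler Q y x) (by
    intro z hz
    obtain ⟨y, hy, rfl⟩ := Multiset.mem_map.1 hz
    exact h.euler_nonneg y (Multiset.mem_cons_of_mem hy) x hx)
  omega

theorem IsRigidDecomp.one_le_right (hC : IsPosSimplyLaced C) (hQ : IsDynkinQuiver C Q)
    {v x : I → ℤ} {s : Multiset (I → ℤ)} (h : IsRigidDecomp C Q v s) (hx : x ∈ s) :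
    1 ≤ euler Q x v := by
  obtain ⟨t, rfl⟩ := Multiset.exists_cons_of_mem hx
  rw [← h.sum_eq, Multiset.sum_cons, map_add, (h.isPosRoot x hx).euler_self hC hQ]
  have : euler Q x t.sum = (t.map fun y => euler Q x y).sum :=
    map_multiset_sum (euler Q x) t
  rw [this]
  have := Multiset.sum_nonneg (s := t.map fun y => euler Q x y) (by
    intro z hz
    obtain ⟨y, hy, rfl⟩ := Multiset.mem_map.1 hz
    exact h.euler_nonneg x hx y (Multiset.mem_cons_of_mem hy))
  omega

theorem euler_simpleRoot_le (Q : Digraph I) (i : I) {v : I → ℤ} (hv : 0 ≤ v) :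
    euler Q (simpleRoot i) v ≤ v i := by
  classical
  rw [euler_apply, simpleRoot_dotProduct, mulVec, dotProduct]
  simp only [eulerMatrix, of_apply, sub_mul, Finset.sum_sub_distrib, ite_mul, one_mul, zero_mul,
    Finset.sum_ite_eq, Finset.mem_univ, if_true]
  have := Finset.sum_nonneg (s := Finset.univ) (f := fun a => if Q.Adj i a then v a else 0)
    (fun a _ => by split_ifs; exacts [hv a, le_rfl])
  linarith

/-- Here c counts the copies of α_i to split off. If c > 0, the remainder satisfies ⟨α_i, v'⟩ = 0,
so its reflection vanishes at i and no summand pairs negatively with α_i. -/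
theorem IsRigidDecomp.of_reflect (hC : IsPosSimplyLaced C) (hQ : IsDynkinQuiver C Q) {i : I}
    (hi : IsSource Q i) {v : I → ℤ} (hv : 0 ≤ v) {c : ℕ}
    (hc : (c : ℤ) = max 0 (euler Q (simpleRoot i) v)) {s : Multiset (I → ℤ)}
    (hs : IsRigidDecomp C (reflect i Q) (simpleReflection C i (v - (c : ℤ) • simpleRoot i)) s) :
    IsRigidDecomp C Q v (s.map (simpleReflection C i) + Multiset.replicate c (simpleRoot i)) := by
  have hQ' := hQ.reflect i
  set v' := v - (c : ℤ) • simpleRoot i with hv'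
  have hle := euler_simpleRoot_le Q i hv
  have hvi := hv i
  have hαα := (isPosRoot_simpleRoot hC i).euler_self hC hQ
  simp only [Pi.zero_apply] at hvi
  have hni : simpleRoot i ∉ s := by
    intro hmem
    have h1 := hs.one_le_left hC hQ' hmem
    have h2 := euler_reflect hC hQ hi v' (simpleRoot i)
    rw [simpleReflection_simpleRoot hC, map_neg, euler_of_source hi] at h2
    simp [hv', simpleRoot] at h2
    simp [hv', simpleRoot] at h1
    omega
  have hpos : ∀ x ∈ s, IsPosRoot C (simpleReflection C i x) := fun x hx =>
    (hs.isPosRoot x hx).simpleReflection hC hQ (fun h => hni (h ▸ hx))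
  have hlast : 0 < c → ∀ x ∈ s, x i ≤ 0 := by
    intro hc0 x hx
    have h1 : x i ≤ simpleReflection C i v' i := hs.le hx i
    have h2 := euler_source_left hC hQ hi v'
    have h3 : euler Q (simpleRoot i) v' = euler Q (simpleRoot i) v - c := by
      rw [hv', map_sub, map_smul, hαα]; simp
    omega
  refine ⟨?_, ?_, ?_⟩
  · intro x hx
    rcases Multiset.mem_add.1 hx with hx | hx
    · obtain ⟨y, hy, rfl⟩ := Multiset.mem_map.1 hx
      exact hpos y hy
    · rw [Multiset.eq_of_mem_replicate hx]
      exact isPosRoot_simpleRoot hC i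
  · have h1 : (s.map (simpleReflection C i)).sum = simpleReflection C i s.sum :=
      (map_multiset_sum (simpleReflection C i) s).symm
    rw [Multiset.sum_add, h1, hs.sum_eq, simpleReflection_simpleReflection hC,
      Multiset.sum_replicate, hv']
    simp
  · intro x hx y hy
    rcases Multiset.mem_add.1 hx with hx | hx <;> rcases Multiset.mem_add.1 hy with hy | hy
    · obtain ⟨x', hx', rfl⟩ := Multiset.mem_map.1 hx
      obtain ⟨y', hy', rfl⟩ := Multiset.mem_map.1 hy
      rw [← euler_reflect hC hQ hi, simpleReflection_simpleReflection hC,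
        simpleReflection_simpleReflection hC]
      exact hs.euler_nonneg x' hx' y' hy'
    · obtain ⟨x', hx', rfl⟩ := Multiset.mem_map.1 hx
      rw [Multiset.eq_of_mem_replicate hy, euler_of_source hi]
      exact (hpos x' hx').1 i
    · obtain ⟨y', hy', rfl⟩ := Multiset.mem_map.1 hy
      rw [Multiset.eq_of_mem_replicate hx, euler_source_left hC hQ hi,
        simpleReflection_simpleReflection hC]
      have := hlast (Nat.pos_of_ne_zero fun h => by simp [h] at hx) y' hy'
      omega
    · rw [Multiset.eq_of_mem_replicate hx, Multiset.eq_of_mem_replicate hy, hαα]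
      exact zero_le_one

theorem simpleReflection_nonneg (hC : IsPosSimplyLaced C) (hQ : IsDynkinQuiver C Q) {i : I}
    (hi : IsSource Q i) {v : I → ℤ} (hv : 0 ≤ v) (h : euler Q (simpleRoot i) v ≤ 0) :
    0 ≤ simpleReflection C i v := by
  intro a
  by_cases ha : a = i
  · subst ha
    rw [euler_source_left hC hQ hi] at h
    simp only [Pi.zero_apply]
    omega
  · rw [simpleReflection_apply_of_ne ha]
    exact hv a

/-- Every nonnegative vector is the dimension vector of a rigid representation. -/
theorem exists_isRigidDecomp (hC : IsPosSimplyLaced C) (hQ : IsDynkinQuiver C Q) {v : I → ℤ}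
    (hv : 0 ≤ v) : ∃ s, IsRigidDecomp C Q v s := by
  induction hN : (euler Q v v).toNat using Nat.strong_induction_on generalizing Q v with
  | _ N ih =>
  by_contra hcon
  have hnn : ∀ {R : Digraph I}, IsDynkinQuiver C R → ∀ x, 0 ≤ euler R x x := by
    intro R hR x
    have h1 := hC.form_nonneg x
    rw [euler_self hC hR] at h1
    omega
  have hv0 : v = 0 := by
    -- The closed family consists of the counterexamples of minimal Euler norm; it can contain only
    -- 0, which has the empty decomposition.
    refine eq_zero_of_closed hC (N := 2 * N) (B := fun R x => IsDynkinQuiver C R ∧ 0 ≤ x ∧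
      (euler R x x).toNat = N ∧ ¬ ∃ s, IsRigidDecomp C R x s) ?_ (fun R x h => h.2.1) ?_ hQ
      ⟨hQ, hv, hN, hcon⟩
    · rintro R x i ⟨hR, hx, hNx, hns⟩ hi
      have hR' := hR.reflect i
      have hle : euler R (simpleRoot i) x ≤ 0 := by
        by_contra hpos
        push Not at hpos
        obtain ⟨c, hc⟩ := Int.eq_ofNat_of_zero_le hpos.le
        have e1 : euler R (simpleRoot i) (x - (c : ℤ) • simpleRoot i) = 0 := by
          rw [map_sub, map_smul, (isPosRoot_simpleRoot hC i).euler_self hC hR, hc]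
          simp
        have hxi := euler_simpleRoot_le R i hx
        have hx' : 0 ≤ x - (c : ℤ) • simpleRoot i := by
          intro a
          by_cases ha : a = i
          · subst ha; simp [simpleRoot]; omega
          · have := hx a
            simp [simpleRoot, ha]; simpa using this
        -- The norm drops by c · x_i, which is positive since 0 < c ≤ x_i.
        have e2 : euler R (x - (c : ℤ) • simpleRoot i) (x - (c : ℤ) • simpleRoot i) =
            euler R x x - c * x i := by
          rw [LinearMap.map_sub₂, LinearMap.map_smul₂, e1, map_sub, map_smul, euler_of_source hi]
          simp
        have h0 := hnn hR (x - (c : ℤ) • simpleRoot i)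
        obtain ⟨s, hs⟩ := ih _ (by
          rw [euler_reflect hC hR hi, e2]
          rw [e2] at h0
          have : 0 < (c : ℤ) * x i := mul_pos (by omega) (by omega)
          omega) hR' (simpleReflection_nonneg hC hR hi hx' e1.le) rfl
        exact hns ⟨_, hs.of_reflect hC hR hi hx (by omega)⟩
      refine ⟨hR', simpleReflection_nonneg hC hR hi hx hle, by rwa [euler_reflect hC hR hi], ?_⟩
      rintro ⟨s, hs⟩
      exact hns ⟨_, IsRigidDecomp.of_reflect hC hR hi hx (c := 0) (by simp [hle])
        (by simpa using hs)⟩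
    · rintro R x ⟨hR, hx, hNx, -⟩
      have := hnn hR x
      rw [euler_self hC hR]
      omega
  subst hv0
  exact hcon ⟨0, by simp, by simp, by simp⟩

end Decomposition

/-! ### The bilexicographic order -/

section BiLex

theorem BiLexLT.trans {N : ℕ} {a b c : Fin N → ℕ} (h₁ : BiLexLT a b) (h₂ : BiLexLT b c) :
    BiLexLT a c := by
  obtain ⟨k₁, s₁, h1, h2, h3, h4, h5⟩ := h₁
  obtain ⟨k₂, s₂, g1, g2, g3, g4, g5⟩ := h₂
  refine ⟨min k₁ k₂, max s₁ s₂, (min_le_left _ _).trans (h1.trans (le_max_left _ _)),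
    fun t ht => ?_, ?_, fun t ht => ?_, ?_⟩
  · rw [lt_min_iff] at ht
    rw [h2 t ht.1, g2 t ht.2]
  · rcases lt_trichotomy k₁ k₂ with h | h | h
    · rw [min_eq_left h.le, ← g2 k₁ h]; exact h3
    · subst h; rw [min_self]; exact h3.trans g3
    · rw [min_eq_right h.le, h2 k₂ h]; exact g3
  · rw [max_lt_iff] at ht
    rw [h4 t ht.1, g4 t ht.2]
  · rcases lt_trichotomy s₁ s₂ with h | h | h
    · rw [max_eq_right h.le, h4 s₂ h]; exact g5
    · subst h; rw [max_self]; exact h5.trans g5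
    · rw [max_eq_left h.le, ← g4 s₁ h]; exact h5

theorem BiLexLT.add_left {N : ℕ} {a b : Fin N → ℕ} (c : Fin N → ℕ) (h : BiLexLT a b) :
    BiLexLT (c + a) (c + b) := by
  obtain ⟨k, s, h1, h2, h3, h4, h5⟩ := h
  exact ⟨k, s, h1, fun t ht => by simp [h2 t ht], by simpa using h3,
    fun t ht => by simp [h4 t ht], by simpa using h5⟩

theorem wellFounded_biLexLT (N : ℕ) : WellFounded (BiLexLT (N := N)) := by
  refine Subrelation.wf (r := Pi.Lex (· < ·) (fun {_} => ((· < ·) : ℕ → ℕ → Prop))) ?_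
    (Pi.Lex.wellFounded _ fun _ => wellFounded_lt)
  rintro a b ⟨k, s, -, h2, h3, -⟩
  exact ⟨k, h2, h3⟩

end BiLex

/-! ### Weights, sizes and existence of the socle -/

section Sequences

variable {I : Type*}

theorem weight_add (a b : (I → ℤ) →₀ ℕ) : weight (a + b) = weight a + weight b :=
  Finsupp.sum_add_index' (fun _ => zero_smul _ _) (fun _ _ _ => add_smul _ _ _)

theorem weight_single (x : I → ℤ) : weight (Finsupp.single x 1) = x := by
  simp [weight]

theorem weight_toFinsupp [DecidableEq (I → ℤ)] (s : Multiset (I → ℤ)) :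
    weight (Multiset.toFinsupp s) = s.sum := by
  rw [weight, ← Finsupp.sum_toMultiset, Multiset.toFinsupp_toMultiset]

theorem size_add (a b : (I → ℤ) →₀ ℕ) : size (a + b) = size a + size b :=
  Finsupp.sum_add_index' (fun _ => rfl) (fun _ _ _ => rfl)

theorem size_single (x : I → ℤ) (n : ℕ) : size (Finsupp.single x n) = n := by
  simp [size]

theorem single_add_single_le {m : (I → ℤ) →₀ ℕ} {α β : I → ℤ} (h : α ≠ β) (hα : 0 < m α)
    (hβ : 0 < m β) : Finsupp.single α 1 + Finsupp.single β 1 ≤ m := by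
  classical
  intro x
  rw [Finsupp.add_apply, Finsupp.single_apply, Finsupp.single_apply]
  split_ifs with h1 h2 h2
  · exact absurd (h1.trans h2.symm) h
  · subst h1; omega
  · subst h2; omega
  · omega

theorem two_le_size {m : (I → ℤ) →₀ ℕ} {α β : I → ℤ} (h : α ≠ β) (hα : 0 < m α)
    (hβ : 0 < m β) : 2 ≤ size m := by
  rw [← tsub_add_cancel_of_le (single_add_single_le h hα hβ), size_add, size_add, size_single,
    size_single]
  omega

variable [Fintype I] [DecidableEq I] {C : Matrix I I ℤ} {Q : Digraph I}

theorem ClassLT.trans {l : List I} {a b c : (I → ℤ) →₀ ℕ} (h₁ : ClassLT C l a b)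
    (h₂ : ClassLT C l b c) : ClassLT C l a c :=
  fun l' hl => (h₁ l' hl).trans (h₂ l' hl)

theorem ClassLT.add_left {l : List I} {a b : (I → ℤ) →₀ ℕ} (c : (I → ℤ) →₀ ℕ)
    (h : ClassLT C l a b) : ClassLT C l (c + a) (c + b) :=
  fun l' hl => (h l' hl).add_left (coords C l' c)

theorem isPair_single_add_single {l : List I} {α β : I → ℤ} (h : α ≠ β)
    (hα : α ∈ wordRoots C l) (hβ : β ∈ wordRoots C l) :
    IsPair C l (Finsupp.single α 1 + Finsupp.single β 1) := by
  classical
  refine ⟨fun x hx => ?_, fun x => ?_, by rw [size_add, size_single, size_single]⟩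
  · rw [Finsupp.add_apply, Finsupp.single_apply, Finsupp.single_apply] at hx
    split_ifs at hx with h1 h2 h2
    · exact h1 ▸ hα
    · exact h1 ▸ hα
    · exact h2 ▸ hβ
    · exact absurd rfl hx
  · rw [Finsupp.add_apply, Finsupp.single_apply, Finsupp.single_apply]
    split_ifs with h1 h2 h2
    · exact absurd (h1.trans h2.symm) h
    all_goals omega

theorem exists_isSocle {l : List I} {p : (I → ℤ) →₀ ℕ} (hp : IsRootSeq C l p) :
    ∃ s, IsSocle C l p s := by
  obtain ⟨s, ⟨hs1, hs2, hs3⟩, hmin⟩ := (InvImage.wf (coords C l)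
    (wellFounded_biLexLT l.length)).has_min
    {m | IsRootSeq C l m ∧ weight p = weight m ∧ ClassLE C l m p} ⟨p, hp, rfl, Or.inl rfl⟩
  refine ⟨s, ⟨hs1, ?_⟩, hs2, hs3⟩
  by_contra hcon
  push Not at hcon
  obtain ⟨-, α, β, hne, hα, hβ, hns⟩ := hcon
  have hpair := isPair_single_add_single hne (hs1 α hα.ne') (hs1 β hβ.ne')
  obtain ⟨m, hm1, hm2, hm3⟩ := not_not.1 fun h => hns ⟨hpair, h⟩
  have hle := tsub_add_cancel_of_le (single_add_single_le hne hα hβ)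
  set r := s - (Finsupp.single α 1 + Finsupp.single β 1) with hr
  have hlt : ClassLT C l (r + m) s := by
    have := hm2.add_left r
    rwa [hle] at this
  refine hmin (r + m) ⟨fun x hx => ?_, ?_, Or.inr ?_⟩ (hlt l (Relation.EqvGen.refl l))
  · by_cases hmx : m x = 0
    · refine hs1 x fun h0 => hx ?_
      have : r x ≤ s x := by rw [hr]; exact tsub_le_self (a := s) x
      rw [Finsupp.add_apply]
      omega
    · exact hm1 x hmx
  · rw [hs2, weight_add, hm3, ← weight_add, hle]
  · rcases hs3 with rfl | h
    · exact hlt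
    · exact hlt.trans h

end Sequences

/-! ### Simple pairs have vanishing Euler pairing -/

section Key

variable {I : Type*} [Fintype I] [DecidableEq I] {C : Matrix I I ℤ} {Q : Digraph I}

theorem IsAdapted.of_append {u v : List I} (h : IsAdapted Q (u ++ v)) : IsAdapted Q u := by
  induction u generalizing Q with
  | nil => trivial
  | cons i u ih => exact ⟨h.1, ih h.2⟩

/-- Write β = s_i b. Since ⟨α_i, β⟩ = −b_i < 0, the vector b − α_i = s_i(α_i + β) is nonnegative and
can be decomposed for the reflected quiver. A summand x has ⟨b − α_i, x⟩ ≥ 1 and ⟨α_i, x⟩ = x_i ≥ 0,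
hence ⟨b, x⟩ > 0, so x occurs no later than b. -/
theorem exists_isRigidDecomp_between_cons (hC : IsPosSimplyLaced C) (hQ : IsDynkinQuiver C Q)
    {i j : I} {v r : List I} (hl : IsReduced C (i :: (v ++ j :: r)))
    (ha : IsAdapted Q (i :: (v ++ j :: r)))
    (he : euler Q (simpleRoot i) (wordProd C (i :: v) (simpleRoot j)) < 0) :
    ∃ s, IsRigidDecomp C Q (simpleRoot i + wordProd C (i :: v) (simpleRoot j)) s ∧
      ∀ x ∈ s, ∃ y ∈ rootList C v, x = simpleReflection C i y := by
  obtain ⟨hi, ha⟩ := ha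
  have hQ' := hQ.reflect i
  set b := wordProd C v (simpleRoot j) with hb
  have hbpos : IsPosRoot C b := hl.tail.isPosRoot hC hQ (mem_rootList.2 ⟨v, j, r, rfl, rfl⟩)
  rw [wordProd_cons, euler_source_left hC hQ hi, simpleReflection_simpleReflection hC,
    ← hb] at he
  have hx : 0 ≤ b - simpleRoot i := by
    intro a
    by_cases hai : a = i
    · subst hai; simp [simpleRoot]; omega
    · have h1 : 0 ≤ b a := hbpos.1 a
      simpa [simpleRoot, hai] using h1
  obtain ⟨s, hs⟩ := exists_isRigidDecomp hC hQ' hx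
  have hmem : ∀ x ∈ s, x ∈ rootList C v := by
    intro x hxs
    have h1 := hs.one_le_left hC hQ' hxs
    have h2 : 0 ≤ x i := (hs.isPosRoot x hxs).1 i
    rw [LinearMap.map_sub₂, euler_of_sink hi.sink_reflect] at h1
    have ha' : IsAdapted (reflect i Q) (v ++ [j]) := by
      rw [List.append_cons] at ha
      exact ha.of_append
    have h3 := mem_rootList_of_euler_pos hC hQ' v j ha' (hs.isPosRoot x hxs) (by rw [← hb]; omega)
    rw [rootList_append] at h3
    rcases List.mem_append.1 h3 with h3 | h3
    · exact h3
    · have h4 : x = b := by simpa [rootList] using h3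
      have h5 : x i ≤ (b - simpleRoot i) i := hs.le hxs i
      rw [h4] at h5
      simp [simpleRoot] at h5
  refine ⟨s.map (simpleReflection C i), ⟨fun x hx => ?_, ?_, ?_⟩, fun x hx => ?_⟩
  · obtain ⟨y, hy, rfl⟩ := Multiset.mem_map.1 hx
    refine hl.isPosRoot hC hQ (List.mem_cons_of_mem _ (List.mem_map_of_mem ?_))
    rw [rootList_append]
    exact List.mem_append_left _ (hmem y hy)
  · have h1 : (s.map (simpleReflection C i)).sum = simpleReflection C i s.sum :=
      (map_multiset_sum (simpleReflection C i) s).symm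
    rw [h1, hs.sum_eq, map_sub, simpleReflection_simpleRoot hC, wordProd_cons]
    abel
  · intro x hx y hy
    obtain ⟨x, hxs, rfl⟩ := Multiset.mem_map.1 hx
    obtain ⟨y, hys, rfl⟩ := Multiset.mem_map.1 hy
    rw [← euler_reflect hC hQ hi, simpleReflection_simpleReflection hC,
      simpleReflection_simpleReflection hC]
    exact hs.euler_nonneg x hxs y hys
  · obtain ⟨y, hy, rfl⟩ := Multiset.mem_map.1 hx
    exact ⟨y, hmem y hy, rfl⟩

theorem exists_isRigidDecomp_between (hC : IsPosSimplyLaced C) (hQ : IsDynkinQuiver C Q)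
    {i j : I} {u v r : List I} (hl : IsReduced C (u ++ i :: (v ++ j :: r)))
    (ha : IsAdapted Q (u ++ i :: (v ++ j :: r)))
    (he : euler Q (wordProd C u (simpleRoot i)) (wordProd C (u ++ i :: v) (simpleRoot j)) < 0) :
    ∃ s, IsRigidDecomp C Q
        (wordProd C u (simpleRoot i) + wordProd C (u ++ i :: v) (simpleRoot j)) s ∧
      ∀ x ∈ s, ∃ y ∈ rootList C v, x = wordProd C (u ++ [i]) y := by
  induction u generalizing Q with
  | nil => exact exists_isRigidDecomp_between_cons hC hQ hl ha he
  | cons k u ih =>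
    obtain ⟨hk, ha⟩ := ha
    obtain ⟨s, hs, hmem⟩ := ih (hQ.reflect k) hl.tail ha (by
      rwa [List.cons_append, wordProd_cons, wordProd_cons, ← euler_reflect hC hQ hk,
        simpleReflection_simpleReflection hC, simpleReflection_simpleReflection hC] at he)
    refine ⟨s.map (simpleReflection C k), ⟨fun x hx => ?_, ?_, ?_⟩, fun x hx => ?_⟩
    · obtain ⟨z, hz, rfl⟩ := Multiset.mem_map.1 hx
      obtain ⟨y, hy, rfl⟩ := hmem z hz
      rw [← wordProd_cons]
      refine hl.isPosRoot hC hQ ?_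
      rw [List.append_cons, rootList_append]
      refine List.mem_append_right _ (List.mem_map_of_mem ?_)
      rw [rootList_append]
      exact List.mem_append_left _ hy
    · have h1 : (s.map (simpleReflection C k)).sum = simpleReflection C k s.sum :=
        (map_multiset_sum (simpleReflection C k) s).symm
      rw [h1, hs.sum_eq, map_add, List.cons_append, wordProd_cons, wordProd_cons]
    · intro x hx y hy
      obtain ⟨x, hxs, rfl⟩ := Multiset.mem_map.1 hx
      obtain ⟨y, hys, rfl⟩ := Multiset.mem_map.1 hy
      rw [← euler_reflect hC hQ hk, simpleReflection_simpleReflection hC,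
        simpleReflection_simpleReflection hC]
      exact hs.euler_nonneg x hxs y hys
    · obtain ⟨z, hz, rfl⟩ := Multiset.mem_map.1 hx
      obtain ⟨y, hy, rfl⟩ := hmem z hz
      exact ⟨y, hy, by rw [List.cons_append, wordProd_cons]⟩

theorem euler_wordRoot (hC : IsPosSimplyLaced C) (hQ : IsDynkinQuiver C Q) {l : List I}
    (hl : IsReduced C l) (ha : IsAdapted Q l) {k m : Fin l.length} (h : k < m) :
    0 ≤ euler Q (wordRoot C l m) (wordRoot C l k) ∧
      euler Q (wordRoot C l k) (wordRoot C l m) ≤ 0 := by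
  rw [wordRoot_eq_getElem, wordRoot_eq_getElem]
  exact List.pairwise_iff_getElem.1 (pairwise_rootList hC hQ hl ha) k m _ _ h

theorem isPosRoot_wordRoot (hC : IsPosSimplyLaced C) (hQ : IsDynkinQuiver C Q) {l : List I}
    (hl : IsReduced C l) (k : Fin l.length) : IsPosRoot C (wordRoot C l k) :=
  hl.isPosRoot hC hQ (mem_wordRoots.1 ⟨k, rfl⟩)

theorem wordRoot_injective (hC : IsPosSimplyLaced C) (hQ : IsDynkinQuiver C Q) {l : List I}
    (hl : IsReduced C l) (ha : IsAdapted Q l) : Function.Injective (wordRoot C l) := by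
  intro k m h
  by_contra hne
  have h1 := (isPosRoot_wordRoot hC hQ hl k).euler_self hC hQ
  rcases lt_or_gt_of_ne hne with h2 | h2
  · have := (euler_wordRoot hC hQ hl ha h2).2
    rw [← h] at this
    omega
  · have := (euler_wordRoot hC hQ hl ha h2).2
    rw [← h] at this
    omega

theorem lt_of_euler (hC : IsPosSimplyLaced C) (hQ : IsDynkinQuiver C Q) {l : List I}
    (hl : IsReduced C l) (ha : IsAdapted Q l) {k m : Fin l.length}
    (hne : wordRoot C l k ≠ wordRoot C l m)
    (h : 0 < euler Q (wordRoot C l m) (wordRoot C l k) ∨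
      euler Q (wordRoot C l k) (wordRoot C l m) < 0) : k < m := by
  rcases lt_trichotomy k m with h1 | h1 | h1
  · exact h1
  · exact absurd (congrArg _ h1) hne
  · have := euler_wordRoot hC hQ hl ha h1
    omega

theorem exists_lt_of_mem {l : List I} {k m : Fin l.length} (hkm : k < m) :
    ∃ v r, l = l.take k ++ l.get k :: (v ++ l.get m :: r) ∧
      l.take m = l.take k ++ l.get k :: v := by
  have h1 : l = l.take m ++ l.get m :: l.drop (m + 1) := by simp
  have h2 : l.take m = l.take k ++ l.get k :: (l.take m).drop (k + 1) := by
    have hk : (k : ℕ) < (l.take m).length := by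
      rw [List.length_take]; have := m.2; have : (k : ℕ) < m := hkm; omega
    have := (List.take_append_drop k (l.take m)).symm
    rw [List.drop_eq_getElem_cons hk, List.take_take,
      min_eq_left (Fin.lt_def.1 hkm).le] at this
    simpa using this
  refine ⟨(l.take m).drop (k + 1), l.drop (m + 1), ?_, h2⟩
  conv_lhs => rw [h1, h2]
  simp

/-- Two roots of an adapted reduced word on which the Euler form is negative do not form a simple
pair. -/
theorem not_isSimplePair (hC : IsPosSimplyLaced C) (hQ : IsDynkinQuiver C Q) {l : List I}
    (hl : IsReduced C l) (ha : IsAdapted Q l) {k m : Fin l.length} (hkm : k < m)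
    (he : euler Q (wordRoot C l k) (wordRoot C l m) < 0) :
    ¬ IsSimplePair C l (Finsupp.single (wordRoot C l k) 1 + Finsupp.single (wordRoot C l m) 1) := by
  classical
  rintro ⟨-, hns⟩
  obtain ⟨v, r, hlv, htake⟩ := exists_lt_of_mem hkm
  set u := l.take k with hu
  set i := l.get k with hi
  set j := l.get m with hj
  have hα : wordRoot C l k = wordProd C u (simpleRoot i) := rfl
  have hβ : wordRoot C l m = wordProd C (u ++ i :: v) (simpleRoot j) := by
    rw [wordRoot, htake]
  obtain ⟨s, hs, hmem⟩ := exists_isRigidDecomp_between hC hQ (u := u) (i := i) (j := j) (v := v)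
    (r := r) (hlv ▸ hl) (hlv ▸ ha) (by rwa [hα, hβ] at he)
  rw [← hα, ← hβ] at hs
  set α := wordRoot C l k with hα'
  set β := wordRoot C l m with hβ'
  have hαpos : euler Q α α = 1 := (isPosRoot_wordRoot hC hQ hl k).euler_self hC hQ
  have hβpos : euler Q β β = 1 := (isPosRoot_wordRoot hC hQ hl m).euler_self hC hQ
  have hroots : rootList C l = rootList C u ++ α :: ((rootList C v).map (wordProd C (u ++ [i])) ++
      β :: (rootList C r).map (wordProd C (u ++ i :: v ++ [j]))) := by
    have : l = u ++ ([i] ++ (v ++ ([j] ++ r))) := by rw [hlv]; simp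
    conv_lhs => rw [this]
    have hfun : ∀ a b : List I, (wordProd C a : (I → ℤ) → _) ∘ wordProd C b =
        wordProd C (a ++ b) := fun a b => funext fun x => (wordProd_append a b x).symm
    simp only [rootList_append, List.map_append, List.map_map, hfun, hα, hβ]
    simp [rootList, wordProd_append, wordProd_cons, ← hfun]
  have hpw := pairwise_rootList hC hQ hl ha
  rw [hroots, List.pairwise_append, List.pairwise_cons, List.pairwise_append] at hpw
  have hbetween : ∀ x ∈ s, x ∈ wordRoots C l ∧ euler Q α x ≤ 0 ∧ euler Q x β ≤ 0 := by
    intro x hx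
    obtain ⟨y, hy, rfl⟩ := hmem x hx
    have hy' := List.mem_map_of_mem (f := wordProd C (u ++ [i])) hy
    refine ⟨?_, ?_, ?_⟩
    · rw [mem_wordRoots, hroots]
      exact List.mem_append_right _ (List.mem_cons_of_mem _ (List.mem_append_left _ hy'))
    · exact (hpw.2.1.1 _ (List.mem_append_left _ hy')).2
    · exact (hpw.2.1.2.2.2 _ hy' _ List.mem_cons_self).2
  refine hns ⟨Multiset.toFinsupp s, fun x hx => ?_, fun l' hl' => ?_, ?_⟩
  · refine (hbetween x ?_).1
    rwa [Multiset.toFinsupp_apply, Multiset.count_ne_zero] at hx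
  · have hinv := hl'.invariants hC hQ
    have hr' := hl.of_commEquiv hC hQ hl'
    have ha' := hinv.1.1 ha
    have hget : ∀ x ∈ wordRoots C l, ∃ t, wordRoot C l' t = x := fun x hx =>
      mem_wordRoots.2 (hinv.2.2.2.mem_iff.1 (mem_wordRoots.1 hx))
    obtain ⟨k', hk'⟩ := hget α ⟨k, rfl⟩
    obtain ⟨m', hm'⟩ := hget β ⟨m, rfl⟩
    have hinj := wordRoot_injective hC hQ hr' ha'
    have hlt : k' < m' := lt_of_euler hC hQ hr' ha'
      (by rw [hk', hm']; intro h; rw [← h] at he; omega) (Or.inr (by rwa [hk', hm']))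
    -- From ⟨α + β, x⟩ ≥ 1 and ⟨α, x⟩ ≤ 0 follows ⟨β, x⟩ > 0, which puts x before β in any adapted
    -- word; dually ⟨x, α⟩ > 0 puts x after α.
    have hpos : ∀ t, wordRoot C l' t ∈ s → k' < t ∧ t < m' := by
      intro t ht
      obtain ⟨-, h1, h2⟩ := hbetween _ ht
      have h3 := hs.one_le_left hC hQ ht
      have h4 := hs.one_le_right hC hQ ht
      rw [map_add] at h4
      rw [LinearMap.map_add₂] at h3
      constructor
      · refine lt_of_euler hC hQ hr' ha' (fun h => ?_) (Or.inl ?_)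
        · rw [← h, hk'] at h1; omega
        · rw [hk']; omega
      · refine lt_of_euler hC hQ hr' ha' (fun h => ?_) (Or.inl ?_)
        · rw [h, hm'] at h2; omega
        · rw [hm']; omega
    have hzero : ∀ t, ¬ (k' < t ∧ t < m') →
        coords C l' (Multiset.toFinsupp s) t = 0 := fun t ht => by
      rw [coords, Multiset.toFinsupp_apply, Multiset.count_eq_zero]
      exact fun h => ht (hpos t h)
    have hp : ∀ t, coords C l' (Finsupp.single α 1 + Finsupp.single β 1) t =
        (if k' = t then 1 else 0) + (if m' = t then 1 else 0) := by
      intro t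
      rw [coords, Finsupp.add_apply, Finsupp.single_apply, Finsupp.single_apply, ← hk', ← hm']
      simp only [hinj.eq_iff]
    refine ⟨k', m', hlt.le, fun t ht => ?_, ?_, fun t ht => ?_, ?_⟩
    · rw [hzero t (fun h => absurd h.1 ht.asymm), hp, if_neg ht.ne', if_neg (ht.trans hlt).ne']
    · rw [hzero k' (fun h => lt_irrefl _ h.1), hp]
      simp
    · rw [hzero t (fun h => absurd h.2 ht.asymm), hp, if_neg (hlt.trans ht).ne, if_neg ht.ne]
    · rw [hzero m' (fun h => lt_irrefl _ h.2), hp]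
      simp
  · rw [weight_toFinsupp, weight_add, weight_single, weight_single, hs.sum_eq]

end Key

/-! ### A simple sequence is determined by its weight -/

section Uniqueness

variable {I : Type*} [Fintype I] [DecidableEq I] {C : Matrix I I ℤ} {Q : Digraph I}

theorem IsSimpleSeq.euler_eq_zero (hC : IsPosSimplyLaced C) (hQ : IsDynkinQuiver C Q) {l : List I}
    (hl : IsReduced C l) (ha : IsAdapted Q l) {s : (I → ℤ) →₀ ℕ} (hs : IsSimpleSeq C l s)
    {k m : Fin l.length} (hkm : k < m) (hk : 0 < s (wordRoot C l k))
    (hm : 0 < s (wordRoot C l m)) : euler Q (wordRoot C l k) (wordRoot C l m) = 0 := by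
  have hne : wordRoot C l k ≠ wordRoot C l m := fun h =>
    hkm.ne (wordRoot_injective hC hQ hl ha h)
  refine le_antisymm (euler_wordRoot hC hQ hl ha hkm).2 (not_lt.1 fun he => ?_)
  rcases hs.2 with h | h
  · have := two_le_size hne hk hm
    omega
  · exact not_isSimplePair hC hQ hl ha hkm he (h _ _ hne hk hm)

theorem weight_eq_sum {l : List I} (hinj : Function.Injective (wordRoot C l))
    {m : (I → ℤ) →₀ ℕ} (hm : IsRootSeq C l m) :
    weight m = ∑ k, m (wordRoot C l k) • wordRoot C l k := by
  classical
  rw [weight, Finsupp.sum, ← Finset.sum_image (f := fun x => m x • x)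
    (g := wordRoot C l) (s := Finset.univ) (fun _ _ _ _ h => hinj h)]
  refine Finset.sum_subset (fun x hx => ?_) (fun x _ hx => ?_)
  · obtain ⟨k, rfl⟩ := hm x (Finsupp.mem_support_iff.1 hx)
    exact Finset.mem_image_of_mem _ (Finset.mem_univ k)
  · rw [Finsupp.notMem_support_iff.1 hx, zero_smul]

/-- Compare the pairings of β_k with both weights. Beyond k the terms of s vanish by simplicity and
those of s' are at most 0, so a larger entry of s at k makes its total strictly larger. -/
theorem IsSimpleSeq.not_lt_of_weight_eq (hC : IsPosSimplyLaced C) (hQ : IsDynkinQuiver C Q)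
    {l : List I} (hl : IsReduced C l) (ha : IsAdapted Q l) {s s' : (I → ℤ) →₀ ℕ}
    (hs : IsSimpleSeq C l s) (hs' : IsRootSeq C l s') (hw : weight s = weight s')
    {k : Fin l.length} (hk : ∀ t < k, s (wordRoot C l t) = s' (wordRoot C l t)) :
    ¬ s' (wordRoot C l k) < s (wordRoot C l k) := by
  intro hlt
  have hinj := wordRoot_injective hC hQ hl ha
  have h1 := congrArg (euler Q (wordRoot C l k)) hw
  rw [weight_eq_sum hinj hs.1, weight_eq_sum hinj hs', map_sum, map_sum] at h1
  refine absurd h1 (ne_of_gt (Finset.sum_lt_sum (fun t _ => ?_) ⟨k, Finset.mem_univ _, ?_⟩))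
  · simp only [map_nsmul]
    rw [nsmul_eq_mul, nsmul_eq_mul]
    rcases lt_trichotomy t k with h | h | h
    · rw [hk t h]
    · subst h
      rw [(isPosRoot_wordRoot hC hQ hl t).euler_self hC hQ]
      omega
    · by_cases h0 : s (wordRoot C l t) = 0
      · rw [h0, Nat.cast_zero, zero_mul]
        exact mul_nonpos_of_nonneg_of_nonpos (Nat.cast_nonneg _)
          (euler_wordRoot hC hQ hl ha h).2
      · rw [hs.euler_eq_zero hC hQ hl ha h (by omega) (by omega), mul_zero, mul_zero]
  · simp only [map_nsmul]
    rw [nsmul_eq_mul, nsmul_eq_mul]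
    rw [(isPosRoot_wordRoot hC hQ hl k).euler_self hC hQ]
    omega

theorem IsSimpleSeq.eq_of_weight_eq (hC : IsPosSimplyLaced C) (hQ : IsDynkinQuiver C Q)
    {l : List I} (hl : IsReduced C l) (ha : IsAdapted Q l) {s s' : (I → ℤ) →₀ ℕ}
    (hs : IsSimpleSeq C l s) (hs' : IsSimpleSeq C l s') (hw : weight s = weight s') : s = s' := by
  by_contra hne
  have hex : ∃ k, s (wordRoot C l k) ≠ s' (wordRoot C l k) := by
    by_contra hall
    push Not at hall
    refine hne (Finsupp.ext fun x => ?_)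
    by_cases hx : x ∈ wordRoots C l
    · obtain ⟨k, rfl⟩ := hx
      exact hall k
    · rw [not_not.1 (mt (hs.1 x) hx), not_not.1 (mt (hs'.1 x) hx)]
  obtain ⟨k, hk, hmin⟩ := (wellFounded_lt (α := Fin l.length)).has_min
    {k | s (wordRoot C l k) ≠ s' (wordRoot C l k)} hex
  have hmin' : ∀ t < k, s (wordRoot C l t) = s' (wordRoot C l t) := fun t ht =>
    not_not.1 fun h => hmin t h ht
  rcases lt_or_gt_of_ne hk with h | h
  · exact hs'.not_lt_of_weight_eq hC hQ hl ha hs.1 hw.symm (fun t ht => (hmin' t ht).symm) h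
  · exact hs.not_lt_of_weight_eq hC hQ hl ha hs'.1 hw hmin' h

end Uniqueness

end AdaptedSocle

theorem mainTheorem3 {I : Type*} [Fintype I] [DecidableEq I] (C : Matrix I I ℤ)
    (hC : AdaptedSocle.IsADE C)
    (Q : Digraph I) (hQ : AdaptedSocle.IsDynkinQuiver C Q)
    (w : List I) (hred : AdaptedSocle.IsReduced C w) (hadapted : AdaptedSocle.IsAdapted Q w)
    (p : (I → ℤ) →₀ ℕ) (hp : AdaptedSocle.IsPair C w p) :
    ∃! s : (I → ℤ) →₀ ℕ, AdaptedSocle.IsSocle C w p s := by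
  obtain ⟨s, hs⟩ := AdaptedSocle.exists_isSocle hp.1
  exact ⟨s, hs, fun s' hs' => hs'.1.eq_of_weight_eq hC.isPosSimplyLaced hQ hred hadapted hs.1
    (hs'.2.1.symm.trans hs.2.1)⟩
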